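/- Let $(S_1,\mathcal F_1,\mu_1)$ and $(S_2,\mathcal F_2,\mu_2)$ be arbitrary probability spaces. A graphon on a measurable space $S$ is a symmetric function $W:S\times S\to[0,1]$ that is measurable for the product $\sigma$-field. For $\varphi:S\to T$ and $W:T\times T\to\mathbb R$ the pull-back is $W^\varphi(x,y)=W(\varphi(x),\varphi(y))$. The cut norm of $U\in L^1(S^2,\mu\times\mu)$ is $\|U\|_\square=\sup_{A,B}\bigl|\int_{A\times B}U\,d(\mu\times\mu)\bigr|$, the supremum being over all measurable $A,B\subseteq S$. Graphons $W_1$ on $(S_1,\mu_1)$ and $W_2$ on $(S_2,\mu_2)$ are equivalent, $W_1\cong W_2$, if $$\delta_\square(W_1,W_2)=\inf\|W_1^{\varphi_1}-W_2^{\varphi_2}\|_\square=0,$$ the infimum being over all pairs of measure-preserving maps $\varphi_i:\Omega\to S_i$ ($i=1,2$) from a common, arbitrary probability space $\Omega$. For a graphon $W$ on a probability space $(S,\mathcal F,\mu)$ let $\psi_W:S\to L^1(S,\mu)$ be the map $x\mapsto W_x=W(x,\cdot)$, let $\mu_W$ be the push-forward of $\mu$ under $\psi_W$ (a Borel probability measure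 on $L^1(S,\mu)$), and let $$S_W=\operatorname{supp}\mu_W=\{f\in L^1(S,\mu):\mu_W(U)>0\text{ for every neighbourhood }U\text{ of }f\},$$ equipped with the metric of $L^1(S,\mu)$, its Borel $\sigma$-field and the measure $\mu_W$. Let $\hat W$ denote any graphon on $S_W$ such that for $\mu\times\mu$-almost every $(x,y)$ one has $\psi_W(x),\psi_W(y)\in S_W$ and $\hat W(\psi_W(x),\psi_W(y))=W(x,y)$. Theorem 9.4. Let $W_1$ and $W_2$ be graphons on $(S_1,\mu_1)$ and $(S_2,\mu_2)$. Graphons $\hat W_1$ and $\hat W_2$ as above exist, and for every choice of them the following are equivalent: (i) $W_1\cong W_2$; (ii) there is a measure-preserving bijection $\varphi:S_{W_1}\to S_{W_2}$ with measurable inverse such that $\hat W_2^{\varphi}=\hat W_1$ $\mu_{W_1}\times\mu_{W_1}$-a.e.; (iii) there is an isometric measure-preserving bijection $\varphi:S_{W_1}\to S_{W_2}$ such that $\hat W_2^{\varphi}=\hat W_1$ $\mu_{W_1}\times\mu_{W_1}$-a.e. In particular, if $W_1\cong W_2$, then the metric spaces $S_{W_1}$ and $S_{W_2}$ are isometric;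 that is, the metric space $S_W$ is, up to isometry, an invariant of the graph limit (the equivalence class) of $W$. -/

import Mathlib

open MeasureTheory

universe u v

noncomputable section

/-- A graphon on a measurable space `S`: a symmetric function `S × S → [0, 1]` that is measurable
for the product σ-field. -/
structure Graphon (S : Type u) [MeasurableSpace S] where
  toFun : S → S → ℝ
  measurable_toFun : Measurable fun p : S × S => toFun p.1 p.2
  symm_toFun : ∀ x y, toFun x y = toFun y x
  mem_Icc_toFun : ∀ x y, toFun x y ∈ Set.Icc (0 : ℝ) 1

namespace Graphon

instance instCoeFun (S : Type u) [MeasurableSpace S] : CoeFun (Graphon S) fun _ => S → S → ℝ :=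
  ⟨Graphon.toFun⟩

/-- The pull-back `W^φ (x, y) = W (φ x, φ y)`. -/
def pullback {S : Type u} {T : Type v} (φ : S → T) (W : T → T → ℝ) : S → S → ℝ :=
  fun x y => W (φ x) (φ y)

/-! ### Cut norm, cut metric, equivalence -/

/-- The cut norm `sup_{A, B} |∫_{A × B} U dμ dμ|`, over all measurable sets `A` and `B`. -/
def cutNorm {S : Type u} [MeasurableSpace S] (μ : Measure S) (U : S → S → ℝ) : ℝ :=
  sSup {r : ℝ | ∃ A B : Set S, MeasurableSet A ∧ MeasurableSet B ∧
    r = |∫ p in A ×ˢ B, U p.1 p.2 ∂(μ.prod μ)|}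

/-- The cut metric: the infimum of the cut norm of `W₁^φ₁ - W₂^φ₂` over all couplings, i.e. all
pairs of measure preserving maps `φ₁ : Ω → S₁`, `φ₂ : Ω → S₂` on a common arbitrary probability
space `Ω`. (The universe of `Ω` contains `S₁ × S₂`; pushing a coupling forward to `S₁ × S₂` does
not change the cut norm.) -/
def cutDist {S₁ : Type u} [MeasurableSpace S₁] (μ₁ : Measure S₁) (W₁ : Graphon S₁)
    {S₂ : Type v} [MeasurableSpace S₂] (μ₂ : Measure S₂) (W₂ : Graphon S₂) : ℝ :=
  sInf {r : ℝ | ∃ (Ω : Type (max u v)) (_ : MeasurableSpace Ω) (μ : Measure Ω)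
    (φ₁ : Ω → S₁) (φ₂ : Ω → S₂),
    IsProbabilityMeasure μ ∧ MeasurePreserving φ₁ μ μ₁ ∧ MeasurePreserving φ₂ μ μ₂ ∧
      r = cutNorm μ (pullback φ₁ W₁ - pullback φ₂ W₂)}

/-- Two graphons are equivalent if their cut distance is zero. -/
def Equivalent {S₁ : Type u} [MeasurableSpace S₁] (μ₁ : Measure S₁) (W₁ : Graphon S₁)
    {S₂ : Type v} [MeasurableSpace S₂] (μ₂ : Measure S₂) (W₂ : Graphon S₂) : Prop :=
  cutDist μ₁ W₁ μ₂ W₂ = 0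

/-! ### The canonical space of a graphon -/

/-- `L¹(S, μ)` carries its Borel σ-field. -/
instance instMeasurableSpaceL1 {S : Type u} [MeasurableSpace S] (μ : Measure S) :
    MeasurableSpace (Lp ℝ 1 μ) :=
  borel _

instance instBorelSpaceL1 {S : Type u} [MeasurableSpace S] (μ : Measure S) :
    BorelSpace (Lp ℝ 1 μ) :=
  ⟨rfl⟩

section Canonical

variable {S : Type u} [MeasurableSpace S] (μ : Measure S) [IsProbabilityMeasure μ]
  (W : Graphon S)

/-- Each section `W_x = W (x, ·)` lies in `L¹`. -/
theorem memLp_section (x : S) : MemLp (W x) 1 μ := by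
  refine MemLp.of_bound (C := 1) ?_ ?_
  · exact (W.measurable_toFun.comp measurable_prodMk_left).aestronglyMeasurable
  · refine Filter.Eventually.of_forall fun y => ?_
    have h := W.mem_Icc_toFun x y
    rw [Real.norm_eq_abs, abs_of_nonneg h.1]
    exact h.2

/-- The map `ψ_W : S → L¹(S, μ)`, `x ↦ W_x`. -/
def psi (x : S) : Lp ℝ 1 μ :=
  (memLp_section μ W x).toLp (W x)

/-- The push-forward `μ_W` of `μ` under `ψ_W`, as a Borel measure on `L¹(S, μ)`. -/
def sectionLaw : Measure (Lp ℝ 1 μ) :=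
  μ.map (psi μ W)

/-- The space `S_W`: the support of `μ_W` in `L¹(S, μ)`. As a type it carries the metric of
`L¹(S, μ)` and the corresponding Borel σ-field. -/
def canonicalSpace : Set (Lp ℝ 1 μ) :=
  (sectionLaw μ W).support

/-- The measure `μ_W`, as a measure on `S_W`. -/
def canonicalMeasure : Measure (canonicalSpace μ W) :=
  (sectionLaw μ W).comap Subtype.val

/-- `V` is a version of the canonical graphon `Ŵ` on `S_W`, that is, `V^{ψ_W} = W` almost
everywhere, where `ψ_W` takes values in `S_W` almost everywhere. -/
def IsCanonicalVersion (V : Graphon (canonicalSpace μ W)) : Prop :=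
  ∀ᵐ p ∂(μ.prod μ), ∃ (h₁ : psi μ W p.1 ∈ canonicalSpace μ W)
    (h₂ : psi μ W p.2 ∈ canonicalSpace μ W), V ⟨psi μ W p.1, h₁⟩ ⟨psi μ W p.2, h₂⟩ = W p.1 p.2

end Canonical

end Graphon

end

/-!
Why the theorem holds.

*Existence of the canonical graphon.* The section map `ψ_W` is strongly measurable
(`stronglyMeasurable_psi`), so its law `μ_W` lives on a separable closed subset of `L¹` even when
`L¹` is not separable, and `S_W` is a Polish space of full measure. Simple functions of `ψ_W`
approximate `ψ_W` in `L¹`, so that `W (x, y)` is an `L¹`-limit of functions of `(ψ_W x, y)`. By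
symmetry it is also a limit of functions of `(x, ψ_W y)`, hence almost every section of `W` factors
through `ψ_W`. Taking the values of the simple functions among such sections,
`W` becomes an `L¹`-limit of functions of `(ψ_W x, ψ_W y)`; as these form a closed subspace, `W` is
itself of this form (`exists_isCanonicalVersion`).

*Equivalence gives an isometry.* Let `U = W₁^φ₁ - W₂^φ₂` for couplings with cut norm tending to `0`.
Each `W_i` is `L¹`-close to a step function that does not depend on the coupling, so
`∫ U W_i^φ_i → 0` and therefore `∫ U² = ∫ U W₁^φ₁ - ∫ U W₂^φ₂ → 0`
(`exists_integral_abs_le_of_cutNorm_lt`). Hence the `L¹`-distance of the two pull-backs tends to `0`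
as well. This distance is a continuous function of the coupling of `μ_{W₁}` and `μ_{W₂}`, and the
couplings of two measures on Polish spaces form a compact set by Prokhorov's theorem, so some
coupling `ρ` of the canonical measures satisfies `Ŵ₁ (f, f') = Ŵ₂ (g, g')` for almost all
`(f, g), (f', g')` (`Equivalent.exists_coupling`). Since the distance of two points of `S_W` is
`∫ |Ŵ (f, h) - Ŵ (f', h)| dμ_W(h)`, the measure `ρ` is concentrated on a set on which the two
distances agree, and the closure of that set is the graph of an isometry, which carries `μ_{W₁}` to
`μ_{W₂}` and `Ŵ₁` to `Ŵ₂` (`Equivalent.exists_isometryEquiv`).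

*A measure preserving bijection gives equivalence.* The probability spaces are arbitrary, so they
need not admit a coupling along their maps to `S_{W₁} ≃ S_{W₂}`. But `Ŵ₁` is `L¹`-close to a step
function on a finite partition, and two probability spaces can always be coupled so that
corresponding parts of a finite partition are matched (`exists_coupling_of_map_eq`); this makes the
cut norm arbitrarily small (`equivalent_of_measurableEquiv`).
-/

noncomputable section

open Filter Topology

namespace Graphon

/-! ### Monotone class argument for bounded functions on a product -/

section BoundedInduction

variable {X Y : Type*} [MeasurableSpace X] [MeasurableSpace Y]

/-- A property of bounded measurable functions on a product that holds for indicators of rectangles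
and passes to linear combinations and bounded pointwise limits holds for all of them. -/
theorem bounded_measurable_induction_prod {P : (X × Y → ℝ) → Prop}
    (rect : ∀ A B, MeasurableSet A → MeasurableSet B → P ((A ×ˢ B).indicator 1))
    (add : ∀ f g, Measurable f → Measurable g → (∃ C, ∀ p, |f p| ≤ C) → (∃ C, ∀ p, |g p| ≤ C) →
      P f → P g → P (f + g))
    (smul : ∀ (c : ℝ) f, Measurable f → (∃ C, ∀ p, |f p| ≤ C) → P f → P (c • f))
    (lim : ∀ (f : ℕ → X × Y → ℝ) g C, (∀ n, Measurable (f n)) → Measurable g →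
      (∀ n p, |f n p| ≤ C) → (∀ p, Tendsto (fun n => f n p) atTop (𝓝 (g p))) →
      (∀ n, P (f n)) → P g)
    {f : X × Y → ℝ} (hf : Measurable f) {C : ℝ} (hC : ∀ p, |f p| ≤ C) : P f := by
  have bdd_ind : ∀ s : Set (X × Y), ∀ p, |s.indicator (1 : X × Y → ℝ) p| ≤ 1 := by
    intro s p
    by_cases h : p ∈ s <;> simp [h]
  have meas_ind : ∀ s : Set (X × Y), MeasurableSet s →
      Measurable (s.indicator (1 : X × Y → ℝ)) := fun s hs => measurable_one.indicator hs
  have ind : ∀ s : Set (X × Y), MeasurableSet s → P (s.indicator 1) := by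
    intro s hs
    induction s, hs using MeasurableSpace.induction_on_inter generateFrom_prod.symm
      isPiSystem_prod with
    | empty => simpa using rect ∅ ∅ .empty .empty
    | basic t ht =>
      obtain ⟨A, hA, B, hB, rfl⟩ := ht
      exact rect A B hA hB
    | compl t ht ih =>
      have h1 : P (Set.indicator Set.univ 1) := by
        simpa using rect Set.univ Set.univ .univ .univ
      have h2 := add _ _ (meas_ind _ .univ) ((meas_ind t ht).const_smul (-1 : ℝ)) ⟨1, bdd_ind _⟩
        ⟨1, fun p => by simpa using bdd_ind t p⟩ h1 (smul (-1) _ (meas_ind t ht) ⟨1, bdd_ind t⟩ ih)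
      convert h2 using 1
      ext p
      by_cases h : p ∈ t <;> simp [h]
    | iUnion t hd ht ih =>
      have hsum : ∀ n, P ((⋃ i ∈ Finset.range n, t i).indicator 1) := by
        intro n
        induction n with
        | zero => simpa using rect ∅ ∅ .empty .empty
        | succ n ihn =>
          have hm : MeasurableSet (⋃ i ∈ Finset.range n, t i) :=
            Finset.measurableSet_biUnion _ fun i _ => ht i
          have h2 := add _ _ (meas_ind _ hm) (meas_ind _ (ht n)) ⟨1, bdd_ind _⟩ ⟨1, bdd_ind _⟩
            ihn (ih n)
          have hdis : Disjoint (⋃ i ∈ Finset.range n, t i) (t n) := by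
            simp only [Set.disjoint_iUnion_left]
            intro i hi
            exact hd (Finset.mem_range.1 hi).ne
          have hU : (⋃ i ∈ Finset.range (n + 1), t i) = (⋃ i ∈ Finset.range n, t i) ∪ t n := by
            rw [Finset.range_add_one, Finset.set_biUnion_insert, Set.union_comm]
          rw [hU, Set.indicator_union_of_disjoint hdis]
          exact h2
      refine lim _ _ 1 (fun n => meas_ind _ (Finset.measurableSet_biUnion _ fun i _ => ht i))
        (meas_ind _ (.iUnion ht)) (fun n p => bdd_ind _ p) (fun p => ?_) hsum
      by_cases h : ∃ i, p ∈ t i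
      · obtain ⟨i, hi⟩ := h
        refine tendsto_const_nhds.congr' ?_
        filter_upwards [eventually_gt_atTop i] with n hn
        rw [Set.indicator_of_mem (Set.mem_iUnion.2 ⟨i, hi⟩), Set.indicator_of_mem]
        exact Set.mem_biUnion (Finset.mem_coe.2 (Finset.mem_range.2 hn)) hi
      · push Not at h
        simp [h]
  have simple : ∀ g : SimpleFunc (X × Y) ℝ, P g := by
    intro g
    induction g using SimpleFunc.induction with
    | const c hs =>
      rename_i s
      convert smul c _ (meas_ind _ hs) ⟨1, bdd_ind _⟩ (ind _ hs) using 1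
      ext p
      by_cases h : p ∈ s <;> simp [h]
    | add =>
      rename_i f g _ _ _
      have hb : ∀ f : SimpleFunc (X × Y) ℝ, ∃ C, ∀ p, |f p| ≤ C := fun f => by
        obtain ⟨C, hC⟩ := f.exists_forall_norm_le
        exact ⟨C, hC⟩
      simpa using add _ _ f.measurable g.measurable (hb f) (hb g) (by assumption) (by assumption)
  have hfs := hf.stronglyMeasurable
  have hC' : ∀ p, ‖f p‖ ≤ C := hC
  refine lim (fun n => hfs.approxBounded C n) f C (fun n => SimpleFunc.measurable _) hf
    (fun n p => ?_) (fun p => ?_) (fun n => simple _)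
  · by_cases h0 : 0 ≤ C
    · exact hfs.norm_approxBounded_le h0 n p
    · exact absurd ((norm_nonneg _).trans (hC' p)) h0
  · exact hfs.tendsto_approxBounded_of_norm_le (hC' p)

end BoundedInduction

/-! ### Sections as points of `L¹` -/

section SectionMap

variable {X Y : Type*} [MeasurableSpace X] [MeasurableSpace Y] (ν : Measure Y) [IsFiniteMeasure ν]

/-- The class of `g` in `L¹(ν)`, with the value `0` if `g` is not integrable. -/
def toL1 (g : Y → ℝ) : Lp ℝ 1 ν :=
  open scoped Classical in if h : MemLp g 1 ν then h.toLp g else 0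

variable {ν}

theorem memLp_of_abs_le {g : Y → ℝ} (hg : Measurable g) {C : ℝ} (hC : ∀ y, |g y| ≤ C) :
    MemLp g 1 ν :=
  MemLp.of_bound hg.aestronglyMeasurable C (.of_forall hC)

theorem integrable_of_abs_le {g : Y → ℝ} (hg : Measurable g) {C : ℝ} (hC : ∀ y, |g y| ≤ C) :
    Integrable g ν :=
  memLp_one_iff_integrable.1 (memLp_of_abs_le hg hC)

omit [IsFiniteMeasure ν] in
theorem toL1_eq {g : Y → ℝ} (h : MemLp g 1 ν) : toL1 ν g = h.toLp g := dif_pos h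

omit [IsFiniteMeasure ν] in
theorem coeFn_toL1 {g : Y → ℝ} (h : MemLp g 1 ν) : toL1 ν g =ᵐ[ν] g := by
  rw [toL1_eq h]
  exact h.coeFn_toLp

omit [IsFiniteMeasure ν] in
theorem dist_L1_eq_integral (f g : Lp ℝ 1 ν) : dist f g = ∫ y, |f y - g y| ∂ν := by
  rw [dist_eq_norm, L1.norm_eq_integral_norm]
  refine integral_congr_ae ?_
  filter_upwards [Lp.coeFn_sub f g] with y hy
  rw [hy, Pi.sub_apply, Real.norm_eq_abs]

omit [IsFiniteMeasure ν] in
theorem dist_toL1 {f g : Y → ℝ} (hf : MemLp f 1 ν) (hg : MemLp g 1 ν) :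
    dist (toL1 ν f) (toL1 ν g) = ∫ y, |f y - g y| ∂ν := by
  rw [dist_L1_eq_integral]
  refine integral_congr_ae ?_
  filter_upwards [coeFn_toL1 hf, coeFn_toL1 hg] with y h1 h2
  rw [h1, h2]

/-- The section map of a bounded jointly measurable function is strongly measurable as a map into
`L¹`; in particular its range is separable, although `L¹(ν)` need not be. -/
theorem stronglyMeasurable_toL1_section {f : X × Y → ℝ} (hf : Measurable f) {C : ℝ}
    (hC : ∀ p, |f p| ≤ C) : StronglyMeasurable fun x => toL1 ν fun y => f (x, y) := by
  have hsec : ∀ {f : X × Y → ℝ}, Measurable f → (∃ C, ∀ p, |f p| ≤ C) → ∀ x,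
      MemLp (fun y => f (x, y)) 1 ν := by
    rintro f hf ⟨C, hC⟩ x
    exact memLp_of_abs_le (hf.comp measurable_prodMk_left) fun y => hC (x, y)
  refine bounded_measurable_induction_prod
    (P := fun f => StronglyMeasurable fun x => toL1 ν fun y => f (x, y)) ?_ ?_ ?_ ?_ hf hC
  · intro A B hA hB
    have h : (fun x => toL1 ν fun y => (A ×ˢ B).indicator (1 : X × Y → ℝ) (x, y)) =
        A.indicator fun _ => toL1 ν (B.indicator (1 : Y → ℝ)) := by
      ext1 x
      by_cases hx : x ∈ A
      · rw [Set.indicator_of_mem hx]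
        congr 1
        ext y
        by_cases hy : y ∈ B <;> simp [hx, hy]
      · rw [Set.indicator_of_notMem hx]
        have : (fun y => (A ×ˢ B).indicator (1 : X × Y → ℝ) (x, y)) = 0 := by
          ext y
          simp [hx]
        rw [this, toL1_eq MemLp.zero]
        exact MemLp.toLp_zero _
    rw [h]
    exact stronglyMeasurable_const.indicator hA
  · intro f g hf hg hfb hgb h1 h2
    have h : (fun x => toL1 ν fun y => (f + g) (x, y)) =
        fun x => (toL1 ν fun y => f (x, y)) + toL1 ν fun y => g (x, y) := by
      ext1 x
      rw [toL1_eq (hsec hf hfb x), toL1_eq (hsec hg hgb x),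
        ← MemLp.toLp_add (hsec hf hfb x) (hsec hg hgb x), ← toL1_eq]
      rfl
    rw [h]
    exact h1.add h2
  · intro c f hf hfb h1
    have h : (fun x => toL1 ν fun y => (c • f) (x, y)) =
        fun x => c • toL1 ν fun y => f (x, y) := by
      ext1 x
      rw [toL1_eq (hsec hf hfb x), ← MemLp.toLp_const_smul c (hsec hf hfb x), ← toL1_eq]
      rfl
    rw [h]
    exact h1.const_smul c
  · intro f g C hf hg hC hlim h1
    refine stronglyMeasurable_of_tendsto atTop h1 (tendsto_pi_nhds.2 fun x => ?_)
    have hgC : ∀ p, |g p| ≤ C := fun p =>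
      le_of_tendsto ((hlim p).abs) (.of_forall fun n => hC n p)
    rw [tendsto_iff_dist_tendsto_zero]
    simp_rw [fun n => dist_toL1 (hsec (hf n) ⟨C, hC n⟩ x) (hsec hg ⟨C, hgC⟩ x)]
    rw [← integral_zero Y ℝ (μ := ν)]
    refine tendsto_integral_of_dominated_convergence (fun _ => 2 * C) (fun n => ?_)
      (integrable_const _) (fun n => .of_forall fun y => ?_) (.of_forall fun y => ?_)
    · exact (((hf n).sub hg).comp measurable_prodMk_left).abs.aestronglyMeasurable
    · rw [Real.norm_eq_abs, abs_abs]
      have h1 := hC n (x, y)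
      have h2 := hgC (x, y)
      have := abs_sub (f n (x, y)) (g (x, y))
      linarith
    · have := (hlim (x, y)).sub_const (g (x, y))
      rw [sub_self] at this
      simpa using this.abs

end SectionMap

/-! ### Approximation by step functions -/

section StepApprox

variable {S : Type*} [MeasurableSpace S] (μ : Measure S) [IsFiniteMeasure μ]

/-- `f` can be approximated in `L¹(μ × μ)` by step functions `c (κ x) (κ y)`, where `κ` is the
measurable map to a finite set describing the steps. -/
def StepApproximable (f : S × S → ℝ) : Prop :=
  ∀ ε > 0, ∃ (ι : Type) (_ : Fintype ι) (_ : MeasurableSpace ι) (_ : DiscreteMeasurableSpace ι)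
    (κ : S → ι) (c : ι → ι → ℝ), Measurable κ ∧
      ∫ p, |f p - c (κ p.1) (κ p.2)| ∂(μ.prod μ) ≤ ε

variable {μ}

theorem integrable_step {ι : Type*} [Fintype ι] [MeasurableSpace ι] [DiscreteMeasurableSpace ι]
    {κ : S → ι} (hκ : Measurable κ) (c : ι → ι → ℝ) (ρ : Measure (S × S)) [IsFiniteMeasure ρ] :
    Integrable (fun p : S × S => c (κ p.1) (κ p.2)) ρ := by
  have hm : Measurable fun p : S × S => c (κ p.1) (κ p.2) :=
    (Measurable.of_discrete (f := fun q : ι × ι => c q.1 q.2)).comp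
      ((hκ.comp measurable_fst).prodMk (hκ.comp measurable_snd))
  refine integrable_of_abs_le hm (C := ∑ i, ∑ j, |c i j|) fun p => ?_
  calc |c (κ p.1) (κ p.2)| ≤ ∑ j, |c (κ p.1) j| :=
        Finset.single_le_sum (f := fun j => |c (κ p.1) j|) (fun _ _ => abs_nonneg _)
          (Finset.mem_univ _)
    _ ≤ _ := Finset.single_le_sum (f := fun i => ∑ j, |c i j|)
        (fun _ _ => Finset.sum_nonneg fun _ _ => abs_nonneg _) (Finset.mem_univ _)

theorem integral_abs_sub_le {Ω : Type*} [MeasurableSpace Ω] {ρ : Measure Ω} {f g h : Ω → ℝ}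
    (hf : Integrable f ρ) (hg : Integrable g ρ) (hh : Integrable h ρ) :
    ∫ p, |f p - h p| ∂ρ ≤ ∫ p, |f p - g p| ∂ρ + ∫ p, |g p - h p| ∂ρ := by
  have h1 : Integrable (fun p => |f p - g p|) ρ := (hf.sub hg).abs
  have h2 : Integrable (fun p => |g p - h p|) ρ := (hg.sub hh).abs
  rw [← integral_add h1 h2]
  exact integral_mono (hf.sub hh).abs (h1.add h2) fun p => abs_sub_le _ _ _

theorem stepApproximable_of_abs_le {f : S × S → ℝ} (hf : Measurable f) {C : ℝ}
    (hC : ∀ p, |f p| ≤ C) : StepApproximable μ f := by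
  refine bounded_measurable_induction_prod (P := StepApproximable μ) ?_ ?_ ?_ ?_ hf hC
  · intro A B hA hB ε hε
    classical
    refine ⟨Prop × Prop, inferInstance, inferInstance, inferInstance,
      fun x => (x ∈ A, x ∈ B), fun i j => if i.1 ∧ j.2 then 1 else 0, hA.mem.prodMk hB.mem, ?_⟩
    refine le_of_eq_of_le (integral_eq_zero_of_ae (.of_forall fun p => ?_)) hε.le
    by_cases h1 : p.1 ∈ A <;> by_cases h2 : p.2 ∈ B <;> simp [h1, h2]
  · rintro f g hf hg ⟨C, hC⟩ ⟨D, hD⟩ h1 h2 ε hε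
    obtain ⟨ι, _, _, _, κ, c, hκ, hc⟩ := h1 (ε / 2) (half_pos hε)
    obtain ⟨ι', _, _, _, κ', c', hκ', hc'⟩ := h2 (ε / 2) (half_pos hε)
    refine ⟨ι × ι', inferInstance, inferInstance, inferInstance, fun x => (κ x, κ' x),
      fun i j => c i.1 j.1 + c' i.2 j.2, hκ.prodMk hκ', ?_⟩
    have i1 : Integrable (fun p => |f p - c (κ p.1) (κ p.2)|) (μ.prod μ) :=
      ((integrable_of_abs_le hf hC).sub (integrable_step hκ c (μ.prod μ))).abs
    have i2 : Integrable (fun p => |g p - c' (κ' p.1) (κ' p.2)|) (μ.prod μ) :=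
      ((integrable_of_abs_le hg hD).sub (integrable_step hκ' c' (μ.prod μ))).abs
    have h3 : ∫ p, |(f + g) p - (c (κ p.1) (κ p.2) + c' (κ' p.1) (κ' p.2))| ∂(μ.prod μ) ≤
        ∫ p, (|f p - c (κ p.1) (κ p.2)| + |g p - c' (κ' p.1) (κ' p.2)|) ∂(μ.prod μ) := by
      refine integral_mono_of_nonneg (.of_forall fun p => abs_nonneg _) (i1.add i2)
        (.of_forall fun p => ?_)
      have := abs_add_le (f p - c (κ p.1) (κ p.2)) (g p - c' (κ' p.1) (κ' p.2))
      refine le_trans (le_of_eq ?_) this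
      simp only [Pi.add_apply]
      congr 1
      ring
    rw [integral_add i1 i2] at h3
    linarith
  · rintro a f hf ⟨C, hC⟩ h1 ε hε
    obtain ⟨ι, _, _, _, κ, c, hκ, hc⟩ := h1 (ε / (|a| + 1)) (by positivity)
    refine ⟨ι, inferInstance, inferInstance, inferInstance, κ, fun i j => a * c i j, hκ, ?_⟩
    have : ∀ p : S × S, |(a • f) p - a * c (κ p.1) (κ p.2)| = |a| * |f p - c (κ p.1) (κ p.2)| := by
      intro p
      rw [← abs_mul, mul_sub]
      rfl
    simp_rw [this]
    rw [integral_const_mul]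
    calc |a| * ∫ p, |f p - c (κ p.1) (κ p.2)| ∂(μ.prod μ) ≤ (|a| + 1) * (ε / (|a| + 1)) := by
          gcongr
          linarith
      _ = ε := by field_simp
  · intro f g C hf hg hC hlim h1 ε hε
    have hgC : ∀ p, |g p| ≤ C := fun p =>
      le_of_tendsto ((hlim p).abs) (.of_forall fun n => hC n p)
    have hconv : Tendsto (fun n => ∫ p, |g p - f n p| ∂(μ.prod μ)) atTop (𝓝 0) := by
      rw [← integral_zero (S × S) ℝ (μ := μ.prod μ)]
      refine tendsto_integral_of_dominated_convergence (fun _ => 2 * C) (fun n => ?_)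
        (integrable_const _) (fun n => .of_forall fun p => ?_) (.of_forall fun p => ?_)
      · exact (hg.sub (hf n)).abs.aestronglyMeasurable
      · rw [Real.norm_eq_abs, abs_abs]
        have h1 := hC n p
        have h2 := hgC p
        have := abs_sub (g p) (f n p)
        linarith
      · have := (hlim p).const_sub (g p)
        rw [sub_self] at this
        simpa using this.abs
    obtain ⟨n, hn⟩ := (hconv.eventually_lt_const (half_pos hε)).exists
    obtain ⟨ι, _, _, _, κ, c, hκ, hc⟩ := h1 n (ε / 2) (half_pos hε)
    refine ⟨ι, inferInstance, inferInstance, inferInstance, κ, c, hκ, ?_⟩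
    have := integral_abs_sub_le (integrable_of_abs_le (ν := μ.prod μ) hg hgC)
      (integrable_of_abs_le (hf n) (hC n)) (integrable_step hκ c (μ.prod μ))
    linarith

end StepApprox

/-! ### The space `S_W` and its measure -/

section CanonicalSpace

variable {S : Type u} [MeasurableSpace S] (μ : Measure S) [IsProbabilityMeasure μ] (W : Graphon S)

theorem abs_le_one {S : Type u} [MeasurableSpace S] (W : Graphon S) (x y : S) : |W x y| ≤ 1 := by
  have h := W.mem_Icc_toFun x y
  rw [abs_of_nonneg h.1]
  exact h.2

theorem psi_eq_toL1 (x : S) : psi μ W x = toL1 μ fun y => W x y :=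
  (toL1_eq (memLp_section μ W x)).symm

theorem coeFn_psi (x : S) : psi μ W x =ᵐ[μ] W x :=
  (memLp_section μ W x).coeFn_toLp

theorem stronglyMeasurable_psi : StronglyMeasurable (psi μ W) := by
  have h := stronglyMeasurable_toL1_section (ν := μ) W.measurable_toFun
    fun p => W.abs_le_one p.1 p.2
  exact (funext (psi_eq_toL1 μ W)) ▸ h

theorem measurable_psi : Measurable (psi μ W) := (stronglyMeasurable_psi μ W).measurable

instance instIsProbabilityMeasureSectionLaw : IsProbabilityMeasure (sectionLaw μ W) :=
  Measure.isProbabilityMeasure_map (measurable_psi μ W).aemeasurable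

theorem isClosed_canonicalSpace : IsClosed (canonicalSpace μ W) := Measure.isClosed_support

theorem closure_range_psi_mem_ae : closure (Set.range (psi μ W)) ∈ ae (sectionLaw μ W) := by
  have : ∀ᵐ f ∂(sectionLaw μ W), f ∈ closure (Set.range (psi μ W)) :=
    (ae_map_iff (measurable_psi μ W).aemeasurable isClosed_closure.measurableSet).2
      (.of_forall fun x => subset_closure ⟨x, rfl⟩)
  exact this

theorem isSeparable_closure_range_psi :
    TopologicalSpace.IsSeparable (closure (Set.range (psi μ W))) :=
  (stronglyMeasurable_psi μ W).isSeparable_range.closure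

theorem canonicalSpace_subset : canonicalSpace μ W ⊆ closure (Set.range (psi μ W)) :=
  Measure.support_subset_of_isClosed isClosed_closure (closure_range_psi_mem_ae μ W)

instance instSeparableSpaceCanonicalSpace :
    TopologicalSpace.SeparableSpace (canonicalSpace μ W) :=
  ((isSeparable_closure_range_psi μ W).mono (canonicalSpace_subset μ W)).separableSpace

instance instSecondCountableTopologyCanonicalSpace :
    SecondCountableTopology (canonicalSpace μ W) :=
  UniformSpace.secondCountable_of_separable _

instance instCompleteSpaceCanonicalSpace : CompleteSpace (canonicalSpace μ W) :=
  (isClosed_canonicalSpace μ W).completeSpace_coe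

/-- The support carries the full mass: `L¹(μ)` itself may fail to be separable, but `μ_W` lives on
a separable closed set. -/
theorem canonicalSpace_mem_ae : canonicalSpace μ W ∈ ae (sectionLaw μ W) := by
  have hsec : SecondCountableTopology (closure (Set.range (psi μ W))) :=
    have := (isSeparable_closure_range_psi μ W).separableSpace
    UniformSpace.secondCountable_of_separable _
  have hlin : IsLindelof (closure (Set.range (psi μ W)) ∩ (canonicalSpace μ W)ᶜ) := by
    have h : IsLindelof
        ((↑) ⁻¹' (canonicalSpace μ W)ᶜ : Set (closure (Set.range (psi μ W)))) :=
      HereditarilyLindelofSpace.isLindelof _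
    have h2 := h.image continuous_subtype_val
    rwa [Subtype.image_preimage_coe] at h2
  have h0 : (closure (Set.range (psi μ W)) ∩ (canonicalSpace μ W)ᶜ)ᶜ ∈ ae (sectionLaw μ W) := by
    refine hlin.compl_mem_sets_of_nhdsWithin fun f hf => ?_
    obtain ⟨U, hU, hU0⟩ := Measure.notMem_support_iff_exists.1 hf.2
    exact ⟨U, mem_nhdsWithin_of_mem_nhds hU, by rwa [compl_mem_ae_iff]⟩
  filter_upwards [h0, closure_range_psi_mem_ae μ W] with f h1 h2
  by_contra h3
  exact h1 ⟨h2, h3⟩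

theorem ae_psi_mem : ∀ᵐ x ∂μ, psi μ W x ∈ canonicalSpace μ W :=
  (ae_map_iff (measurable_psi μ W).aemeasurable (isClosed_canonicalSpace μ W).measurableSet).1
    (canonicalSpace_mem_ae μ W)

instance instNonemptyCanonicalSpace : Nonempty (canonicalSpace μ W) := by
  obtain ⟨x, hx⟩ := (ae_psi_mem μ W).exists
  exact ⟨⟨_, hx⟩⟩

/-- The map `ψ_W`, modified on a null set so that it takes all its values in `S_W`. -/
def toCanonical (x : S) : canonicalSpace μ W :=
  open scoped Classical in
  if h : psi μ W x ∈ canonicalSpace μ W then ⟨psi μ W x, h⟩ else Classical.arbitrary _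

theorem toCanonical_eq {x : S} (h : psi μ W x ∈ canonicalSpace μ W) :
    toCanonical μ W x = ⟨psi μ W x, h⟩ := dif_pos h

theorem ae_coe_toCanonical : ∀ᵐ x ∂μ, (toCanonical μ W x : Lp ℝ 1 μ) = psi μ W x := by
  filter_upwards [ae_psi_mem μ W] with x hx
  rw [toCanonical_eq μ W hx]

theorem measurableEmbedding_canonicalSpace :
    MeasurableEmbedding (Subtype.val : canonicalSpace μ W → Lp ℝ 1 μ) :=
  MeasurableEmbedding.subtype_coe (isClosed_canonicalSpace μ W).measurableSet

theorem measurable_toCanonical : Measurable (toCanonical μ W) := by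
  classical
  rw [← (measurableEmbedding_canonicalSpace μ W).measurable_comp_iff]
  have : Subtype.val ∘ toCanonical μ W = fun x =>
      if psi μ W x ∈ canonicalSpace μ W then psi μ W x
      else (Classical.arbitrary (canonicalSpace μ W) : Lp ℝ 1 μ) := by
    ext1 x
    by_cases h : psi μ W x ∈ canonicalSpace μ W <;> simp [toCanonical, h]
  rw [this]
  exact Measurable.ite (measurable_psi μ W (isClosed_canonicalSpace μ W).measurableSet)
    (measurable_psi μ W) measurable_const

theorem measurePreserving_toCanonical :
    MeasurePreserving (toCanonical μ W) μ (canonicalMeasure μ W) := by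
  refine ⟨measurable_toCanonical μ W, ?_⟩
  rw [canonicalMeasure, sectionLaw, ← Measure.map_congr (ae_coe_toCanonical μ W),
    ← (measurableEmbedding_canonicalSpace μ W).comap_map (μ.map (toCanonical μ W)),
    Measure.map_map measurable_subtype_coe (measurable_toCanonical μ W)]
  rfl

instance instIsProbabilityMeasureCanonicalMeasure : IsProbabilityMeasure (canonicalMeasure μ W) :=
  (measurePreserving_toCanonical μ W).map_eq ▸
    Measure.isProbabilityMeasure_map (measurable_toCanonical μ W).aemeasurable

instance instIsOpenPosMeasureCanonicalMeasure : (canonicalMeasure μ W).IsOpenPosMeasure := by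
  refine ⟨fun U hU ⟨f, hf⟩ => ?_⟩
  obtain ⟨O, hO, rfl⟩ := isOpen_induced_iff.1 hU
  have h1 : 0 < sectionLaw μ W O :=
    (Measure.mem_support_iff_forall (f : Lp ℝ 1 μ)).1 f.2 O (hO.mem_nhds hf)
  rw [canonicalMeasure, (measurableEmbedding_canonicalSpace μ W).comap_apply,
    Subtype.image_preimage_coe, Set.inter_comm, measure_inter_conull]
  · exact h1.ne'
  · exact canonicalSpace_mem_ae μ W

/-- The almost everywhere defined condition on a canonical version, in terms of a total map. -/
theorem isCanonicalVersion_iff (V : Graphon (canonicalSpace μ W)) : IsCanonicalVersion μ W V ↔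
    ∀ᵐ p ∂(μ.prod μ), V (toCanonical μ W p.1) (toCanonical μ W p.2) = W p.1 p.2 := by
  have h1 := Measure.quasiMeasurePreserving_fst (μ := μ) (ν := μ) |>.ae (ae_psi_mem μ W)
  have h2 := Measure.quasiMeasurePreserving_snd (μ := μ) (ν := μ) |>.ae (ae_psi_mem μ W)
  refine eventually_congr ?_
  filter_upwards [h1, h2] with p h1 h2
  rw [toCanonical_eq μ W h1, toCanonical_eq μ W h2]
  exact ⟨fun ⟨_, _, h⟩ => h, fun h => ⟨h1, h2, h⟩⟩

end CanonicalSpace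

/-! ### Existence of the canonical graphon -/

section Existence

variable {S : Type u} [MeasurableSpace S] (μ : Measure S) [IsProbabilityMeasure μ] (W : Graphon S)

theorem edist_L1_eq_lintegral {S : Type*} [MeasurableSpace S] {μ : Measure S} (f g : Lp ℝ 1 μ) :
    edist f g = ∫⁻ y, ‖f y - g y‖ₑ ∂μ := by
  rw [Lp.edist_def, eLpNorm_one_eq_lintegral_enorm]
  rfl

theorem enorm_psi_le (x : S) : ‖psi μ W x‖ₑ ≤ 1 := by
  rw [Lp.enorm_def, eLpNorm_congr_ae (coeFn_psi μ W x), eLpNorm_one_eq_lintegral_enorm]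
  calc ∫⁻ y, ‖W x y‖ₑ ∂μ ≤ ∫⁻ _, 1 ∂μ := by
        refine lintegral_mono fun y => ?_
        rw [← ofReal_norm, ← ENNReal.ofReal_one]
        exact ENNReal.ofReal_le_ofReal (W.abs_le_one x y)
    _ = 1 := by simp

/-- If `ψ_W` takes values in a separable set `s` almost everywhere, it is an `L¹`-limit of simple
functions of `ψ_W` with values in `s`. -/
theorem exists_simpleFunc_tendsto_psi (s : Set (Lp ℝ 1 μ)) [TopologicalSpace.SeparableSpace s]
    (hs : ∀ᵐ x ∂μ, psi μ W x ∈ s) :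
    ∃ φ : ℕ → SimpleFunc (canonicalSpace μ W) (Lp ℝ 1 μ), (∀ n f, φ n f ∈ s) ∧
      Tendsto (fun n => ∫⁻ x, edist (psi μ W x) (φ n (toCanonical μ W x)) ∂μ) atTop (𝓝 0) := by
  obtain ⟨x₀, hx₀⟩ := hs.exists
  have hv : Measurable (Subtype.val : canonicalSpace μ W → Lp ℝ 1 μ) := measurable_subtype_coe
  refine ⟨fun n => SimpleFunc.approxOn _ hv s _ hx₀ n, fun n f => SimpleFunc.approxOn_mem hv hx₀ n f,
    ?_⟩
  rw [← lintegral_zero (μ := μ)]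
  refine tendsto_lintegral_of_dominated_convergence' (fun _ => 2) (fun n => ?_) (fun n => ?_)
    (by simp) ?_
  · have h1 := (stronglyMeasurable_psi μ W).edist
      ((SimpleFunc.stronglyMeasurable (SimpleFunc.approxOn _ hv s _ hx₀ n)).comp_measurable
        (measurable_toCanonical μ W))
    exact h1.aemeasurable
  · filter_upwards [ae_coe_toCanonical μ W] with x hx
    rw [edist_comm, ← hx]
    refine (SimpleFunc.edist_approxOn_le hv hx₀ (toCanonical μ W x) n).trans ?_
    rw [hx]
    refine (edist_triangle_right _ _ 0).trans ?_
    rw [edist_zero_right, edist_zero_right, ← one_add_one_eq_two]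
    exact add_le_add (enorm_psi_le μ W _) (enorm_psi_le μ W _)
  · filter_upwards [ae_coe_toCanonical μ W, hs] with x hx hxs
    have := SimpleFunc.tendsto_approxOn hv hx₀ (x := toCanonical μ W x)
      (subset_closure (by rwa [hx]))
    rw [hx] at this
    have h2 := (tendsto_const_nhds (x := psi μ W x)).edist this
    rwa [edist_self] at h2

/-- The functions in `L¹(μ)` that factor through `ψ_W`. -/
def factoring : Set (Lp ℝ 1 μ) :=
  Set.range (Lp.compMeasurePreserving (E := ℝ) (p := 1) (toCanonical μ W)
    (measurePreserving_toCanonical μ W))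

theorem isClosed_factoring : IsClosed (factoring μ W) :=
  (Lp.isometry_compMeasurePreserving _).isClosedEmbedding.isClosed_range

/-- Almost every section of `W` factors through `ψ_W`: by symmetry, `W (x, y)` depends on `y` only
through `W_y`. -/
theorem ae_psi_mem_factoring : ∀ᵐ x ∂μ, psi μ W x ∈ factoring μ W := by
  obtain ⟨φ, -, hφ⟩ := exists_simpleFunc_tendsto_psi μ W (canonicalSpace μ W) (ae_psi_mem μ W)
  have hle : ∀ n, ∫⁻ x, Metric.infEDist (psi μ W x) (factoring μ W) ∂μ ≤
      ∫⁻ x, edist (psi μ W x) (φ n (toCanonical μ W x)) ∂μ := by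
    intro n
    have hm : Measurable fun p : S × S =>
        ‖W p.1 p.2 - (φ n (toCanonical μ W p.2) : S → ℝ) p.1‖ₑ := by
      have h1 := (φ n).comp (fun p : S × S => toCanonical μ W p.2)
        ((measurable_toCanonical μ W).comp measurable_snd) |>.measurable_bind
        (fun b p => b p.1) fun b => (Lp.stronglyMeasurable b).measurable.comp measurable_fst
      exact (W.measurable_toFun.sub h1).enorm
    calc ∫⁻ x, Metric.infEDist (psi μ W x) (factoring μ W) ∂μ
        ≤ ∫⁻ x, ∫⁻ y, ‖W x y - (φ n (toCanonical μ W y) : S → ℝ) x‖ₑ ∂μ ∂μ := by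
          refine lintegral_mono fun x => ?_
          have hk := SimpleFunc.memLp_of_isFiniteMeasure ((φ n).map fun v : Lp ℝ 1 μ => v x) 1
            (canonicalMeasure μ W)
          -- for fixed `x`, the function `y ↦ φ n (ψ_W y) x` factors through `ψ_W`
          refine (Metric.infEDist_le_edist_of_mem (s := factoring μ W) ⟨hk.toLp _, rfl⟩).trans (le_of_eq ?_)
          rw [edist_L1_eq_lintegral]
          refine lintegral_congr_ae ?_
          have h1 := Lp.coeFn_compMeasurePreserving (hk.toLp _) (measurePreserving_toCanonical μ W)
          have h2 := (measurePreserving_toCanonical μ W).quasiMeasurePreserving.ae hk.coeFn_toLp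
          filter_upwards [coeFn_psi μ W x, h1, h2] with y hy1 hy2 hy3
          rw [hy1, hy2, Function.comp_apply, hy3]
          rfl
      _ = ∫⁻ y, ∫⁻ x, ‖W x y - (φ n (toCanonical μ W y) : S → ℝ) x‖ₑ ∂μ ∂μ :=
          lintegral_lintegral_swap hm.aemeasurable
      _ = _ := by
          refine lintegral_congr fun y => ?_
          rw [edist_L1_eq_lintegral]
          refine lintegral_congr_ae ?_
          filter_upwards [coeFn_psi μ W y] with x hx
          rw [hx, W.symm_toFun x y]
  have h0 : ∫⁻ x, Metric.infEDist (psi μ W x) (factoring μ W) ∂μ = 0 :=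
    le_antisymm (ge_of_tendsto' hφ hle) zero_le
  have hm : Measurable fun x => Metric.infEDist (psi μ W x) (factoring μ W) :=
    Metric.continuous_infEDist.measurable.comp (measurable_psi μ W)
  rw [lintegral_eq_zero_iff hm] at h0
  filter_upwards [h0] with x hx
  refine (isClosed_factoring μ W).closure_eq ▸ Metric.mem_closure_iff_infEDist_zero.2 hx

theorem measurePreserving_prodMap_toCanonical :
    MeasurePreserving (Prod.map (toCanonical μ W) (toCanonical μ W)) (μ.prod μ)
      ((canonicalMeasure μ W).prod (canonicalMeasure μ W)) :=
  (measurePreserving_toCanonical μ W).prod (measurePreserving_toCanonical μ W)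

/-- The canonical graphon exists: `W` is an `L¹`-limit of functions of `(ψ_W x, ψ_W y)`, and such
functions form a closed subspace of `L¹(μ × μ)`. -/
theorem exists_isCanonicalVersion : ∃ V, IsCanonicalVersion μ W V := by
  have hπ := measurePreserving_toCanonical μ W
  have hπ2 := measurePreserving_prodMap_toCanonical μ W
  have hsep : TopologicalSpace.SeparableSpace
      ↥(canonicalSpace μ W ∩ factoring μ W : Set (Lp ℝ 1 μ)) :=
    ((isSeparable_closure_range_psi μ W).mono
      (Set.inter_subset_left.trans (canonicalSpace_subset μ W))).separableSpace
  obtain ⟨φ, hφmem, hφ⟩ := exists_simpleFunc_tendsto_psi μ W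
    (canonicalSpace μ W ∩ factoring μ W)
    ((ae_psi_mem μ W).and (ae_psi_mem_factoring μ W))
  have hWL : MemLp (fun p : S × S => W p.1 p.2) 1 (μ.prod μ) :=
    memLp_of_abs_le W.measurable_toFun fun p => W.abs_le_one p.1 p.2
  have hch : ∀ v : Lp ℝ 1 μ, ∃ k : Lp ℝ 1 (canonicalMeasure μ W),
      v ∈ factoring μ W → Lp.compMeasurePreserving (toCanonical μ W) hπ k = v := by
    intro v
    by_cases hv : v ∈ factoring μ W
    · obtain ⟨k, hk⟩ := hv
      exact ⟨k, fun _ => hk⟩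
    · exact ⟨0, fun h => absurd h hv⟩
  choose k hk using hch
  have hmem : hWL.toLp _ ∈ closure (Set.range (Lp.compMeasurePreserving (E := ℝ) (p := 1) _ hπ2)) := by
    rw [EMetric.mem_closure_iff]
    intro ε hε
    obtain ⟨n, hn⟩ := (hφ.eventually_lt_const hε).exists
    -- `k` lifts the values of `φ n`, functions on `S` that factor through `ψ_W`, to functions on `S_W`
    let K : canonicalSpace μ W × canonicalSpace μ W → ℝ := fun q => k (φ n q.1) q.2
    have hKm : Measurable K :=
      ((φ n).comp _ measurable_fst).measurable_bind
        (fun b (q : canonicalSpace μ W × canonicalSpace μ W) => k b q.2)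
        fun b => (Lp.stronglyMeasurable (k b)).measurable.comp measurable_snd
    have hdiff : eLpNorm ((fun p : S × S => W p.1 p.2) -
        K ∘ Prod.map (toCanonical μ W) (toCanonical μ W)) 1 (μ.prod μ) < ε := by
      refine lt_of_eq_of_lt ?_ hn
      rw [eLpNorm_one_eq_lintegral_enorm, lintegral_prod]
      · refine lintegral_congr fun x => ?_
        rw [edist_L1_eq_lintegral]
        refine lintegral_congr_ae ?_
        have h1 := Lp.coeFn_compMeasurePreserving (k (φ n (toCanonical μ W x))) hπ
        rw [hk _ (hφmem n _).2] at h1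
        filter_upwards [coeFn_psi μ W x, h1] with y hy1 hy2
        rw [hy1, hy2]
        rfl
      · exact (W.measurable_toFun.sub (hKm.comp hπ2.measurable)).enorm.aemeasurable
    have hKL : MemLp K 1 ((canonicalMeasure μ W).prod (canonicalMeasure μ W)) := by
      refine ⟨hKm.aestronglyMeasurable, ?_⟩
      rw [← eLpNorm_comp_measurePreserving hKm.aestronglyMeasurable hπ2]
      have h3 : MemLp ((fun p : S × S => W p.1 p.2) -
          K ∘ Prod.map (toCanonical μ W) (toCanonical μ W)) 1 (μ.prod μ) :=
        ⟨(W.measurable_toFun.sub (hKm.comp hπ2.measurable)).aestronglyMeasurable,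
          hdiff.trans_le le_top⟩
      have h4 := hWL.sub h3
      rw [sub_sub_cancel] at h4
      exact h4.2
    refine ⟨_, ⟨hKL.toLp K, rfl⟩, ?_⟩
    rw [Lp.toLp_compMeasurePreserving hKL hπ2, Lp.edist_toLp_toLp]
    exact hdiff
  rw [(Lp.isometry_compMeasurePreserving hπ2).isClosedEmbedding.isClosed_range.closure_eq] at hmem
  obtain ⟨V₀, hV₀⟩ := hmem
  have hV₀m : Measurable V₀ := (Lp.stronglyMeasurable V₀).measurable
  -- symmetrizing and truncating `V₀` makes it a graphon and does not change it almost everywhere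
  refine ⟨⟨fun f g => max 0 (min 1 ((V₀ (f, g) + V₀ (g, f)) / 2)), ?_, ?_, ?_⟩, ?_⟩
  · exact measurable_const.max (measurable_const.min
      (((hV₀m.comp (measurable_fst.prodMk measurable_snd)).add
        (hV₀m.comp (measurable_snd.prodMk measurable_fst))).div_const 2))
  · intro f g
    rw [add_comm]
  · exact fun f g => ⟨le_max_left _ _, max_le zero_le_one (min_le_left _ _)⟩
  · rw [isCanonicalVersion_iff]
    have h1 := Lp.coeFn_compMeasurePreserving V₀ hπ2
    rw [hV₀] at h1
    have h2 : ∀ᵐ p ∂(μ.prod μ), V₀ (toCanonical μ W p.1, toCanonical μ W p.2) = W p.1 p.2 := by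
      filter_upwards [h1, hWL.coeFn_toLp] with p hp1 hp2
      rw [← hp2, hp1]
      rfl
    have h3 := (Measure.measurePreserving_swap (μ := μ) (ν := μ)).quasiMeasurePreserving.ae h2
    filter_upwards [h2, h3] with p hp1 hp2
    have hp3 : V₀ (toCanonical μ W p.2, toCanonical μ W p.1) = W p.2 p.1 := hp2
    have h4 := W.mem_Icc_toFun p.1 p.2
    change max 0 (min 1 ((V₀ _ + V₀ _) / 2)) = _
    rw [hp1, hp3, W.symm_toFun p.2 p.1, add_self_div_two, min_eq_right h4.2, max_eq_right h4.1]

end Existence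

/-! ### The cut norm against step functions -/

section CutNorm

variable {Ω : Type*} [MeasurableSpace Ω] (μ : Measure Ω)

theorem abs_setIntegral_le_integral_abs {U : Ω × Ω → ℝ} {ρ : Measure (Ω × Ω)}
    (hU : Integrable U ρ) (s : Set (Ω × Ω)) : |∫ p in s, U p ∂ρ| ≤ ∫ p, |U p| ∂ρ :=
  abs_integral_le_integral_abs.trans
    (setIntegral_le_integral hU.abs (.of_forall fun _ => abs_nonneg _))

theorem cutNorm_le_integral_abs {U : Ω → Ω → ℝ}
    (hU : Integrable (fun p : Ω × Ω => U p.1 p.2) (μ.prod μ)) :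
    cutNorm μ U ≤ ∫ p, |U p.1 p.2| ∂(μ.prod μ) := by
  refine csSup_le ⟨_, ∅, ∅, .empty, .empty, rfl⟩ ?_
  rintro r ⟨A, B, -, -, rfl⟩
  exact abs_setIntegral_le_integral_abs hU _

theorem abs_setIntegral_le_cutNorm {U : Ω → Ω → ℝ}
    (hU : Integrable (fun p : Ω × Ω => U p.1 p.2) (μ.prod μ)) {A B : Set Ω}
    (hA : MeasurableSet A) (hB : MeasurableSet B) :
    |∫ p in A ×ˢ B, U p.1 p.2 ∂(μ.prod μ)| ≤ cutNorm μ U := by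
  refine le_csSup ⟨∫ p, |U p.1 p.2| ∂(μ.prod μ), ?_⟩ ⟨A, B, hA, hB, rfl⟩
  rintro r ⟨A, B, -, -, rfl⟩
  exact abs_setIntegral_le_integral_abs hU _

theorem cutNorm_nonneg (U : Ω → Ω → ℝ) : 0 ≤ cutNorm μ U := by
  refine Real.sSup_nonneg ?_
  rintro r ⟨A, B, -, -, rfl⟩
  exact abs_nonneg _

/-- The cut norm controls integrals against step functions, with a constant that depends only on the
values of the step function. -/
theorem abs_integral_mul_step_le {U : Ω → Ω → ℝ}
    (hU : Integrable (fun p : Ω × Ω => U p.1 p.2) (μ.prod μ)) {ι : Type*} [Fintype ι]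
    [MeasurableSpace ι] [DiscreteMeasurableSpace ι] {κ : Ω → ι} (hκ : Measurable κ)
    (c : ι → ι → ℝ) :
    |∫ p, U p.1 p.2 * c (κ p.1) (κ p.2) ∂(μ.prod μ)| ≤ (∑ i, ∑ j, |c i j|) * cutNorm μ U := by
  have hms : ∀ i, MeasurableSet (κ ⁻¹' {i}) := fun i => hκ (measurableSet_singleton i)
  have h1 : ∀ p : Ω × Ω, U p.1 p.2 * c (κ p.1) (κ p.2) =
      ∑ i, ∑ j, c i j * ((κ ⁻¹' {i}) ×ˢ (κ ⁻¹' {j})).indicator (fun p => U p.1 p.2) p := by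
    intro p
    rw [Finset.sum_eq_single (κ p.1), Finset.sum_eq_single (κ p.2)]
    · simp [mul_comm]
    · intro j _ hj
      rw [Set.indicator_of_notMem, mul_zero]
      rintro ⟨-, h⟩
      exact hj (by simpa using h.symm)
    · simp
    · intro i _ hi
      refine Finset.sum_eq_zero fun j _ => ?_
      rw [Set.indicator_of_notMem, mul_zero]
      rintro ⟨h, -⟩
      exact hi (by simpa using h.symm)
    · simp
  have hint : ∀ i j, Integrable (fun p : Ω × Ω =>
      c i j * ((κ ⁻¹' {i}) ×ˢ (κ ⁻¹' {j})).indicator (fun p => U p.1 p.2) p) (μ.prod μ) :=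
    fun i j => (hU.indicator ((hms i).prod (hms j))).const_mul _
  simp_rw [h1]
  rw [integral_finsetSum _ fun i _ => integrable_finsetSum _ fun j _ => hint i j]
  simp_rw [fun i => integral_finsetSum (μ := μ.prod μ) Finset.univ fun j _ => hint i j,
    integral_const_mul, fun i j => integral_indicator (μ := μ.prod μ)
      (f := fun p : Ω × Ω => U p.1 p.2) ((hms i).prod (hms j))]
  rw [Finset.sum_mul]
  refine (Finset.abs_sum_le_sum_abs _ _).trans (Finset.sum_le_sum fun i _ => ?_)
  rw [Finset.sum_mul]
  refine (Finset.abs_sum_le_sum_abs _ _).trans (Finset.sum_le_sum fun j _ => ?_)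
  rw [abs_mul]
  exact mul_le_mul_of_nonneg_left (abs_setIntegral_le_cutNorm μ hU (hms i) (hms j)) (abs_nonneg _)

end CutNorm

/-! ### Couplings with small cut norm -/

section Coupling

variable {S₁ : Type u} [MeasurableSpace S₁] {μ₁ : Measure S₁} [IsProbabilityMeasure μ₁]
  {S₂ : Type v} [MeasurableSpace S₂] {μ₂ : Measure S₂} [IsProbabilityMeasure μ₂]

theorem measurable_pullback {Ω : Type*} [MeasurableSpace Ω] (W : Graphon S₁) {φ : Ω → S₁}
    (hφ : Measurable φ) : Measurable fun p : Ω × Ω => W (φ p.1) (φ p.2) :=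
  W.measurable_toFun.comp (hφ.prodMap hφ)

/-- Integrals of a bounded kernel `U` against a fixed graphon are controlled by the cut norm
of `U`. -/
theorem exists_abs_integral_mul_pullback_le (W : Graphon S₁) {η : ℝ} (hη : 0 < η) :
    ∃ C, 0 ≤ C ∧ ∀ (Ω : Type (max u v)) [MeasurableSpace Ω] (μ : Measure Ω)
      [IsProbabilityMeasure μ] (φ : Ω → S₁), MeasurePreserving φ μ μ₁ → ∀ U : Ω → Ω → ℝ,
      Measurable (fun p : Ω × Ω => U p.1 p.2) → (∀ x y, |U x y| ≤ 1) →
      |∫ p, U p.1 p.2 * W (φ p.1) (φ p.2) ∂(μ.prod μ)| ≤ η + C * cutNorm μ U := by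
  obtain ⟨ι, _, _, _, κ, c, hκ, hc⟩ := stepApproximable_of_abs_le (μ := μ₁) W.measurable_toFun
    (fun p => W.abs_le_one p.1 p.2) η hη
  refine ⟨∑ i, ∑ j, |c i j|, Finset.sum_nonneg fun i _ => Finset.sum_nonneg fun j _ => abs_nonneg _,
    fun Ω _ μ _ φ hφ U hU hU1 => ?_⟩
  have hUi : Integrable (fun p : Ω × Ω => U p.1 p.2) (μ.prod μ) :=
    integrable_of_abs_le hU fun p => hU1 p.1 p.2
  have hκφ : Measurable (κ ∘ φ) := hκ.comp hφ.measurable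
  have hWi : Integrable (fun p : Ω × Ω => W (φ p.1) (φ p.2)) (μ.prod μ) :=
    integrable_of_abs_le (measurable_pullback W hφ.measurable) fun p => W.abs_le_one _ _
  have hsi := integrable_step hκφ c (μ.prod μ)
  have hb : ∀ᵐ p ∂(μ.prod μ), ‖U p.1 p.2‖ ≤ 1 := .of_forall fun p => hU1 p.1 p.2
  have h1 : Integrable (fun p : Ω × Ω => U p.1 p.2 * (W (φ p.1) (φ p.2) -
      c ((κ ∘ φ) p.1) ((κ ∘ φ) p.2))) (μ.prod μ) :=
    (hWi.sub hsi).bdd_mul hU.aestronglyMeasurable hb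
  have h2 : Integrable (fun p : Ω × Ω => U p.1 p.2 * c ((κ ∘ φ) p.1) ((κ ∘ φ) p.2))
      (μ.prod μ) := hsi.bdd_mul hU.aestronglyMeasurable hb
  have h3 : ∫ p, U p.1 p.2 * W (φ p.1) (φ p.2) ∂(μ.prod μ) =
      ∫ p, U p.1 p.2 * (W (φ p.1) (φ p.2) - c ((κ ∘ φ) p.1) ((κ ∘ φ) p.2)) ∂(μ.prod μ) +
      ∫ p, U p.1 p.2 * c ((κ ∘ φ) p.1) ((κ ∘ φ) p.2) ∂(μ.prod μ) := by
    rw [← integral_add h1 h2]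
    refine integral_congr_ae (.of_forall fun p => ?_)
    simp only
    ring
  have h4 : |∫ p, U p.1 p.2 * (W (φ p.1) (φ p.2) - c ((κ ∘ φ) p.1) ((κ ∘ φ) p.2)) ∂(μ.prod μ)|
      ≤ η := by
    refine abs_integral_le_integral_abs.trans (le_trans ?_ hc)
    rw [← (hφ.prod hφ).map_eq, integral_map (hφ.prod hφ).measurable.aemeasurable]
    · refine integral_mono h1.abs (hWi.sub hsi).abs fun p => ?_
      simp only [abs_mul]
      exact mul_le_of_le_one_left (abs_nonneg _) (hU1 _ _)
    · exact ((hφ.prod hφ).map_eq ▸ ((integrable_of_abs_le W.measurable_toFun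
        fun p => W.abs_le_one p.1 p.2).sub (integrable_step hκ c (μ₁.prod μ₁))).abs :
          Integrable (fun p : S₁ × S₁ => |W p.1 p.2 - c (κ p.1) (κ p.2)|)
            ((μ.prod μ).map (Prod.map φ φ))).aestronglyMeasurable
  rw [h3]
  exact (abs_add_le _ _).trans (add_le_add h4 (abs_integral_mul_step_le μ hUi hκφ c))

/-- For two fixed graphons, a coupling that makes the cut norm of the difference `U` small also
makes the `L¹` norm small: `∫ U² = ∫ U W₁ - ∫ U W₂`, and both integrals are controlled by the cut
norm since `W₁` and `W₂` do not depend on the coupling. -/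
theorem exists_integral_abs_le_of_cutNorm_lt (W₁ : Graphon S₁) (W₂ : Graphon S₂) {ε : ℝ}
    (hε : 0 < ε) : ∃ δ > 0, ∀ (Ω : Type (max u v)) [MeasurableSpace Ω] (μ : Measure Ω)
      [IsProbabilityMeasure μ] (φ₁ : Ω → S₁) (φ₂ : Ω → S₂), MeasurePreserving φ₁ μ μ₁ →
      MeasurePreserving φ₂ μ μ₂ → cutNorm μ (pullback φ₁ W₁ - pullback φ₂ W₂) < δ →
      ∫ p, |W₁ (φ₁ p.1) (φ₁ p.2) - W₂ (φ₂ p.1) (φ₂ p.2)| ∂(μ.prod μ) ≤ ε := by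
  obtain ⟨C₁, hC₁, h₁⟩ := exists_abs_integral_mul_pullback_le.{u, v} (μ₁ := μ₁) W₁
    (η := ε ^ 2 / 4) (by positivity)
  obtain ⟨C₂, hC₂, h₂⟩ := exists_abs_integral_mul_pullback_le.{v, u} (μ₁ := μ₂) W₂
    (η := ε ^ 2 / 4) (by positivity)
  refine ⟨ε ^ 2 / (2 * (C₁ + C₂ + 1)), by positivity, fun Ω _ μ _ φ₁ φ₂ hφ₁ hφ₂ hδ => ?_⟩
  set U : Ω → Ω → ℝ := pullback φ₁ W₁ - pullback φ₂ W₂ with hUdef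
  have hUa : ∀ x y, U x y = W₁ (φ₁ x) (φ₁ y) - W₂ (φ₂ x) (φ₂ y) := fun _ _ => rfl
  have hm₁ := measurable_pullback W₁ hφ₁.measurable
  have hm₂ := measurable_pullback W₂ hφ₂.measurable
  have hU : Measurable fun p : Ω × Ω => U p.1 p.2 := hm₁.sub hm₂
  have hU1 : ∀ x y, |U x y| ≤ 1 := by
    intro x y
    have a := W₁.mem_Icc_toFun (φ₁ x) (φ₁ y)
    have b := W₂.mem_Icc_toFun (φ₂ x) (φ₂ y)
    rw [hUa, abs_le]
    constructor <;> linarith [a.1, a.2, b.1, b.2]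
  have hUi : Integrable (fun p : Ω × Ω => U p.1 p.2) (μ.prod μ) :=
    integrable_of_abs_le hU fun p => hU1 p.1 p.2
  have hb : ∀ᵐ p ∂(μ.prod μ), ‖U p.1 p.2‖ ≤ 1 := .of_forall fun p => hU1 p.1 p.2
  have i₁ : Integrable (fun p : Ω × Ω => U p.1 p.2 * W₁ (φ₁ p.1) (φ₁ p.2)) (μ.prod μ) :=
    (integrable_of_abs_le hm₁ fun p => W₁.abs_le_one _ _).bdd_mul hU.aestronglyMeasurable hb
  have i₂ : Integrable (fun p : Ω × Ω => U p.1 p.2 * W₂ (φ₂ p.1) (φ₂ p.2)) (μ.prod μ) :=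
    (integrable_of_abs_le hm₂ fun p => W₂.abs_le_one _ _).bdd_mul hU.aestronglyMeasurable hb
  have hsq : ∫ p, U p.1 p.2 ^ 2 ∂(μ.prod μ) =
      ∫ p, U p.1 p.2 * W₁ (φ₁ p.1) (φ₁ p.2) ∂(μ.prod μ) -
      ∫ p, U p.1 p.2 * W₂ (φ₂ p.1) (φ₂ p.2) ∂(μ.prod μ) := by
    rw [← integral_sub i₁ i₂]
    refine integral_congr_ae (.of_forall fun p => ?_)
    simp only
    rw [← mul_sub, ← hUa, sq]
  have isq : Integrable (fun p : Ω × Ω => U p.1 p.2 ^ 2) (μ.prod μ) := by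
    simp_rw [sq]
    exact hUi.bdd_mul hU.aestronglyMeasurable hb
  have b₁ := (le_abs_self _).trans (h₁ Ω μ φ₁ hφ₁ U hU hU1)
  have b₂ := (neg_le_abs _).trans (h₂ Ω μ φ₂ hφ₂ U hU hU1)
  have hcut : (C₁ + C₂) * cutNorm μ U ≤ ε ^ 2 / 2 := by
    have hn := cutNorm_nonneg μ U
    calc (C₁ + C₂) * cutNorm μ U ≤ (C₁ + C₂ + 1) * (ε ^ 2 / (2 * (C₁ + C₂ + 1))) := by
          refine mul_le_mul (by linarith) hδ.le hn (by linarith)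
      _ = ε ^ 2 / 2 := by field_simp
  have hsq_le : ∫ p, U p.1 p.2 ^ 2 ∂(μ.prod μ) ≤ ε ^ 2 := by
    rw [hsq]
    linarith
  -- the arithmetic-geometric mean inequality in place of the Cauchy-Schwarz inequality
  have hamgm : ∀ t : ℝ, |t| ≤ ε / 2 + t ^ 2 * (1 / (2 * ε)) := by
    intro t
    rw [← sq_abs t]
    have : ε / 2 + |t| ^ 2 * (1 / (2 * ε)) - |t| = (|t| - ε) ^ 2 / (2 * ε) := by
      field_simp
      ring
    have h2 : 0 ≤ (|t| - ε) ^ 2 / (2 * ε) := by positivity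
    linarith
  calc ∫ p, |U p.1 p.2| ∂(μ.prod μ)
      ≤ ∫ p, (ε / 2 + U p.1 p.2 ^ 2 * (1 / (2 * ε))) ∂(μ.prod μ) :=
        integral_mono hUi.abs ((integrable_const _).add (isq.mul_const _)) fun p => hamgm _
    _ = ε / 2 + (∫ p, U p.1 p.2 ^ 2 ∂(μ.prod μ)) * (1 / (2 * ε)) := by
        rw [integral_add (integrable_const _) (isq.mul_const _), integral_mul_const]
        simp
    _ ≤ ε / 2 + ε ^ 2 * (1 / (2 * ε)) := by gcongr
    _ = ε := by field_simp; norm_num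

/-- The infimum defining the cut distance is approached: the product space shows that it is taken
over a nonempty set, so that its value `0` is not a junk value. -/
theorem exists_coupling_cutNorm_lt {W₁ : Graphon S₁} {W₂ : Graphon S₂}
    (h : Equivalent μ₁ W₁ μ₂ W₂) {δ : ℝ} (hδ : 0 < δ) :
    ∃ (Ω : Type (max u v)) (_ : MeasurableSpace Ω) (μ : Measure Ω) (φ₁ : Ω → S₁) (φ₂ : Ω → S₂),
      IsProbabilityMeasure μ ∧ MeasurePreserving φ₁ μ μ₁ ∧ MeasurePreserving φ₂ μ μ₂ ∧
      cutNorm μ (pullback φ₁ W₁ - pullback φ₂ W₂) < δ := by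
  rw [Equivalent, cutDist] at h
  obtain ⟨r, ⟨Ω, m, μ, φ₁, φ₂, h1, h2, h3, rfl⟩, hr⟩ := exists_lt_of_csInf_lt
    (by exact ⟨_, S₁ × S₂, inferInstance, μ₁.prod μ₂, Prod.fst, Prod.snd, inferInstance,
      measurePreserving_fst, measurePreserving_snd, rfl⟩) (h.trans_lt hδ)
  exact ⟨Ω, m, μ, φ₁, φ₂, h1, h2, h3, hr⟩

end Coupling

/-! ### Compactness of couplings on Polish spaces -/

section Compactness

variable {X Y : Type*} [MetricSpace X] [CompleteSpace X] [SecondCountableTopology X]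
  [MeasurableSpace X] [BorelSpace X] [MetricSpace Y] [CompleteSpace Y]
  [SecondCountableTopology Y] [MeasurableSpace Y] [BorelSpace Y]
  (μ : Measure X) [IsProbabilityMeasure μ] (ν : Measure Y) [IsProbabilityMeasure ν]

/-- The couplings of `μ` and `ν`, as probability measures on the product space. -/
def couplings : Set (ProbabilityMeasure (X × Y)) :=
  {ρ | MeasurePreserving Prod.fst (ρ : Measure (X × Y)) μ ∧
    MeasurePreserving Prod.snd (ρ : Measure (X × Y)) ν}

theorem isCompact_couplings : IsCompact (couplings μ ν) := by
  have hcl : IsClosed (couplings μ ν) := by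
    have h : couplings μ ν =
        {ρ | ρ.map (measurable_fst.aemeasurable) = ⟨μ, inferInstance⟩} ∩
        {ρ | ρ.map (measurable_snd.aemeasurable) = ⟨ν, inferInstance⟩} := by
      ext ρ
      change _ ↔ ρ.map _ = _ ∧ ρ.map _ = _
      exact ⟨fun h => ⟨Subtype.ext h.1.map_eq, Subtype.ext h.2.map_eq⟩,
        fun h => ⟨⟨measurable_fst, congrArg Subtype.val h.1⟩,
          ⟨measurable_snd, congrArg Subtype.val h.2⟩⟩⟩
    rw [h]
    exact (isClosed_singleton.preimage (ProbabilityMeasure.continuous_map continuous_fst)).inter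
      (isClosed_singleton.preimage (ProbabilityMeasure.continuous_map continuous_snd))
  have ht : IsTightMeasureSet
      {((ρ : ProbabilityMeasure (X × Y)) : Measure (X × Y)) | ρ ∈ couplings μ ν} := by
    refine IsTightMeasureSet.prodMk
      ((isTightMeasureSet_singleton (μ := μ)).subset ?_)
      ((isTightMeasureSet_singleton (μ := ν)).subset ?_)
    · rintro _ ⟨_, ⟨ρ, hρ, rfl⟩, rfl⟩
      exact hρ.1.map_eq
    · rintro _ ⟨_, ⟨ρ, hρ, rfl⟩, rfl⟩
      exact hρ.2.map_eq
  exact hcl.closure_eq ▸ isCompact_closure_of_isTightMeasureSet ht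

variable {μ ν}

omit [CompleteSpace X] [CompleteSpace Y] in
/-- The `L¹`-distance of the two pull-backs is a continuous function of the coupling, although `V₁`
and `V₂` are merely integrable: replacing them by bounded continuous functions changes it by an
amount that depends only on the marginals. -/
theorem continuousOn_integral_couplings {V₁ : X × X → ℝ} {V₂ : Y × Y → ℝ}
    (h₁ : Integrable V₁ (μ.prod μ)) (h₂ : Integrable V₂ (ν.prod ν)) :
    ContinuousOn (fun ρ : ProbabilityMeasure (X × Y) =>
      ∫ p : (X × Y) × (X × Y), |V₁ (p.1.1, p.2.1) - V₂ (p.1.2, p.2.2)| ∂(ρ.toMeasure.prod ρ.toMeasure))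
      (couplings μ ν) := by
  refine continuousOn_of_uniform_approx_of_continuousOn fun u hu => ?_
  obtain ⟨ε, hε, hu⟩ := Metric.mem_uniformity_dist.1 hu
  obtain ⟨f, hf, hfi⟩ := h₁.exists_boundedContinuous_integral_sub_le (ε := ε / 3) (by positivity)
  obtain ⟨g, hg, hgi⟩ := h₂.exists_boundedContinuous_integral_sub_le (ε := ε / 3) (by positivity)
  let h : BoundedContinuousFunction ((X × Y) × (X × Y)) ℝ :=
    BoundedContinuousFunction.ofNormedAddCommGroup
      (fun p => |f (p.1.1, p.2.1) - g (p.1.2, p.2.2)|) (by fun_prop) (‖f‖ + ‖g‖) fun p => by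
        rw [Real.norm_eq_abs, abs_abs]
        exact (abs_sub _ _).trans (add_le_add (f.norm_coe_le_norm _) (g.norm_coe_le_norm _))
  refine ⟨fun ρ => ∫ p, h p ∂(ρ.toMeasure.prod ρ.toMeasure), ?_, fun ρ hρ => hu ?_⟩
  · have hc : Continuous fun ρ : ProbabilityMeasure (X × Y) => ρ.prod ρ :=
      ProbabilityMeasure.continuous_prod.comp (continuous_id.prodMk continuous_id)
    exact ((ProbabilityMeasure.continuous_integral_boundedContinuousFunction h).comp hc).continuousOn
  · have m₁ := hρ.1.prod hρ.1
    have m₂ := hρ.2.prod hρ.2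
    have iV₁ := m₁.integrable_comp_of_integrable h₁
    have iV₂ := m₂.integrable_comp_of_integrable h₂
    have if' := m₁.integrable_comp_of_integrable hfi
    have ig' := m₂.integrable_comp_of_integrable hgi
    have e₁ : ∫ p, |V₁ (p.1.1, p.2.1) - f (p.1.1, p.2.1)| ∂(ρ.toMeasure.prod ρ.toMeasure) ≤ ε / 3 := by
      refine le_trans (le_of_eq ?_) hf
      rw [← m₁.map_eq, integral_map m₁.measurable.aemeasurable]
      · rfl
      · rw [m₁.map_eq]
        exact (h₁.sub hfi).norm.aestronglyMeasurable
    have e₂ : ∫ p, |V₂ (p.1.2, p.2.2) - g (p.1.2, p.2.2)| ∂(ρ.toMeasure.prod ρ.toMeasure) ≤ ε / 3 := by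
      refine le_trans (le_of_eq ?_) hg
      rw [← m₂.map_eq, integral_map m₂.measurable.aemeasurable]
      · rfl
      · rw [m₂.map_eq]
        exact (h₂.sub hgi).norm.aestronglyMeasurable
    have i₁ : Integrable (fun p : (X × Y) × (X × Y) => |V₁ (p.1.1, p.2.1) - f (p.1.1, p.2.1)|)
        (ρ.toMeasure.prod ρ.toMeasure) := (iV₁.sub if').abs
    have i₂ : Integrable (fun p : (X × Y) × (X × Y) => |V₂ (p.1.2, p.2.2) - g (p.1.2, p.2.2)|)
        (ρ.toMeasure.prod ρ.toMeasure) := (iV₂.sub ig').abs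
    have i₃ : Integrable (fun p : (X × Y) × (X × Y) => |V₁ (p.1.1, p.2.1) - V₂ (p.1.2, p.2.2)|)
        (ρ.toMeasure.prod ρ.toMeasure) := (iV₁.sub iV₂).abs
    have i₄ : Integrable (fun p : (X × Y) × (X × Y) => |f (p.1.1, p.2.1) - g (p.1.2, p.2.2)|)
        (ρ.toMeasure.prod ρ.toMeasure) := (if'.sub ig').abs
    rw [Real.dist_eq]
    change |_ - ∫ p : (X × Y) × (X × Y), |f (p.1.1, p.2.1) - g (p.1.2, p.2.2)| ∂_| < ε
    rw [← integral_sub i₃ i₄]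
    refine (abs_integral_le_integral_abs.trans (integral_mono (i₃.sub i₄).abs (i₁.add i₂)
      fun p => ?_)).trans_lt ?_
    · refine (abs_abs_sub_abs_le_abs_sub _ _).trans (le_trans (le_of_eq ?_) (abs_sub _ _))
      congr 1
      ring
    · simp only [Pi.add_apply]
      rw [integral_add i₁ i₂]
      linarith

/-- If the infimum of the `L¹`-distance over all couplings is `0`, it is attained. -/
theorem exists_coupling_ae_eq {V₁ : X × X → ℝ} {V₂ : Y × Y → ℝ}
    (h₁ : Integrable V₁ (μ.prod μ)) (h₂ : Integrable V₂ (ν.prod ν))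
    (h : ∀ ε > 0, ∃ ρ ∈ couplings μ ν,
      ∫ p : (X × Y) × (X × Y), |V₁ (p.1.1, p.2.1) - V₂ (p.1.2, p.2.2)| ∂(ρ.toMeasure.prod ρ.toMeasure) ≤ ε) :
    ∃ ρ ∈ couplings μ ν, ∀ᵐ p : (X × Y) × (X × Y) ∂(ρ.toMeasure.prod ρ.toMeasure),
      V₁ (p.1.1, p.2.1) = V₂ (p.1.2, p.2.2) := by
  obtain ⟨ρ₁, hρ₁, -⟩ := h 1 one_pos
  obtain ⟨ρ, hρ, hmin⟩ := (isCompact_couplings μ ν).exists_isMinOn ⟨ρ₁, hρ₁⟩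
    (continuousOn_integral_couplings h₁ h₂)
  refine ⟨ρ, hρ, ?_⟩
  have h0 : ∫ p : (X × Y) × (X × Y), |V₁ (p.1.1, p.2.1) - V₂ (p.1.2, p.2.2)| ∂(ρ.toMeasure.prod ρ.toMeasure) = 0 := by
    refine le_antisymm (le_of_forall_pos_le_add fun ε hε => ?_)
      (integral_nonneg fun _ => abs_nonneg _)
    obtain ⟨ρ', hρ', hle⟩ := h ε hε
    rw [zero_add]
    exact (hmin hρ').trans hle
  have i : Integrable (fun p : (X × Y) × (X × Y) => |V₁ (p.1.1, p.2.1) - V₂ (p.1.2, p.2.2)|)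
      (ρ.toMeasure.prod ρ.toMeasure) :=
    (((hρ.1.prod hρ.1).integrable_comp_of_integrable h₁).sub
      ((hρ.2.prod hρ.2).integrable_comp_of_integrable h₂)).abs
  rw [integral_eq_zero_iff_of_nonneg (fun _ => abs_nonneg _) i] at h0
  filter_upwards [h0] with p hp
  exact sub_eq_zero.1 (abs_eq_zero.1 hp)

end Compactness

/-! ### Isometries from distance preserving relations -/

section Isometry

/-- A distance preserving relation with dense projections extends to an isometry of complete spaces:
both projections of its closure are isometric bijections. -/
theorem exists_isometryEquiv_of_dist_eq {X Y : Type*} [MetricSpace X] [CompleteSpace X]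
    [MetricSpace Y] [CompleteSpace Y] {H : Set (X × Y)}
    (hd : ∀ p ∈ H, ∀ q ∈ H, dist p.1 q.1 = dist p.2 q.2)
    (h₁ : Dense (Prod.fst '' H)) (h₂ : Dense (Prod.snd '' H)) :
    ∃ φ : X ≃ᵢ Y, ∀ p ∈ H, φ p.1 = p.2 := by
  have hd' : ∀ p ∈ closure H, ∀ q ∈ closure H, dist p.1 q.1 = dist p.2 q.2 := by
    intro p hp q hq
    have hcl : IsClosed {r : (X × Y) × (X × Y) | dist r.1.1 r.2.1 = dist r.1.2 r.2.2} :=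
      isClosed_eq (by fun_prop) (by fun_prop)
    have hmem : (p, q) ∈ closure (H ×ˢ H) := by
      rw [closure_prod_eq]
      exact ⟨hp, hq⟩
    exact closure_minimal (fun r hr => hd r.1 hr.1 r.2 hr.2) hcl hmem
  have : CompleteSpace (closure H) := isClosed_closure.completeSpace_coe
  have i₁ : Isometry fun p : closure H => p.1.1 := Isometry.of_dist_eq fun p q => by
    rw [Subtype.dist_eq, Prod.dist_eq, ← hd' p p.2 q q.2, max_self]
  have i₂ : Isometry fun p : closure H => p.1.2 := Isometry.of_dist_eq fun p q => by
    rw [Subtype.dist_eq, Prod.dist_eq, hd' p p.2 q q.2, max_self]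
  have s₁ : Function.Surjective fun p : closure H => p.1.1 := by
    rw [← Set.range_eq_univ, ← i₁.isClosedEmbedding.isClosed_range.closure_eq]
    refine (h₁.mono ?_).closure_eq
    rintro _ ⟨p, hp, rfl⟩
    exact ⟨⟨p, subset_closure hp⟩, rfl⟩
  have s₂ : Function.Surjective fun p : closure H => p.1.2 := by
    rw [← Set.range_eq_univ, ← i₂.isClosedEmbedding.isClosed_range.closure_eq]
    refine (h₂.mono ?_).closure_eq
    rintro _ ⟨p, hp, rfl⟩
    exact ⟨⟨p, subset_closure hp⟩, rfl⟩
  let e₁ : closure H ≃ᵢ X := ⟨Equiv.ofBijective _ ⟨i₁.injective, s₁⟩, i₁⟩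
  let e₂ : closure H ≃ᵢ Y := ⟨Equiv.ofBijective _ ⟨i₂.injective, s₂⟩, i₂⟩
  refine ⟨e₁.symm.trans e₂, fun p hp => ?_⟩
  have : e₁.symm p.1 = ⟨p, subset_closure hp⟩ := (e₁.symm_apply_eq).2 rfl
  change e₂ (e₁.symm p.1) = p.2
  rw [this]
  rfl

end Isometry

/-! ### Distances in `S_W` through the canonical graphon -/

section SectionsOfVersion

variable {S : Type u} [MeasurableSpace S] {μ : Measure S} [IsProbabilityMeasure μ] {W : Graphon S}

/-- Almost every point `f` of `S_W`, as a function on `S`, is the section of the canonical graphon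
at `f`. -/
theorem IsCanonicalVersion.ae_coe_eq {V : Graphon (canonicalSpace μ W)}
    (hV : IsCanonicalVersion μ W V) : ∀ᵐ f : canonicalSpace μ W ∂(canonicalMeasure μ W),
      (f : Lp ℝ 1 μ) = toL1 μ fun y => V f (toCanonical μ W y) := by
  rw [← (measurePreserving_toCanonical μ W).map_eq,
    ae_map_iff (measurable_toCanonical μ W).aemeasurable]
  · filter_upwards [Measure.ae_ae_of_ae_prod ((isCanonicalVersion_iff μ W V).1 hV),
      ae_coe_toCanonical μ W] with x hx hx'
    have h1 : MemLp (fun y => V (toCanonical μ W x) (toCanonical μ W y)) 1 μ :=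
      memLp_of_abs_le (V.measurable_toFun.comp
        (measurable_const.prodMk (measurable_toCanonical μ W))) fun y => V.abs_le_one _ _
    rw [hx', toL1_eq h1]
    refine (MemLp.toLp_congr _ _ ?_).symm
    filter_upwards [hx] with y hy using hy
  · refine StronglyMeasurable.measurableSet_eq_fun continuous_subtype_val.stronglyMeasurable ?_
    exact stronglyMeasurable_toL1_section (V.measurable_toFun.comp
      (measurable_id.prodMap (measurable_toCanonical μ W))) fun p => V.abs_le_one _ _

theorem measurable_section {S : Type*} [MeasurableSpace S] (V : Graphon S) (f : S) :
    Measurable (V f) :=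
  V.measurable_toFun.comp measurable_prodMk_left

/-- The metric of `S_W` can be read off from the canonical graphon and `μ_W` alone. -/
theorem dist_eq_integral_section (V : Graphon (canonicalSpace μ W)) {f g : canonicalSpace μ W}
    (hf : (f : Lp ℝ 1 μ) = toL1 μ fun y => V f (toCanonical μ W y))
    (hg : (g : Lp ℝ 1 μ) = toL1 μ fun y => V g (toCanonical μ W y)) :
    dist f g = ∫ h, |V f h - V g h| ∂(canonicalMeasure μ W) := by
  have hmem : ∀ f, MemLp (fun y => V f (toCanonical μ W y)) 1 μ := fun f =>
    memLp_of_abs_le ((measurable_section V f).comp (measurable_toCanonical μ W))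
      fun y => V.abs_le_one _ _
  rw [Subtype.dist_eq, hf, hg, dist_toL1 (hmem f) (hmem g),
    ← (measurePreserving_toCanonical μ W).map_eq,
    integral_map (measurable_toCanonical μ W).aemeasurable]
  exact ((measurable_section V f).sub (measurable_section V g)).abs.aestronglyMeasurable

end SectionsOfVersion

/-! ### Equivalent graphons have isometric canonical spaces -/

section Equivalence

variable {S₁ : Type u} [MeasurableSpace S₁] {μ₁ : Measure S₁} [IsProbabilityMeasure μ₁]
  {S₂ : Type v} [MeasurableSpace S₂] {μ₂ : Measure S₂} [IsProbabilityMeasure μ₂]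
  {W₁ : Graphon S₁} {W₂ : Graphon S₂}
  {V₁ : Graphon (canonicalSpace μ₁ W₁)} {V₂ : Graphon (canonicalSpace μ₂ W₂)}

/-- The infimum in the cut distance of equivalent graphons is attained on the canonical spaces. -/
theorem Equivalent.exists_coupling (h : Equivalent μ₁ W₁ μ₂ W₂)
    (hV₁ : IsCanonicalVersion μ₁ W₁ V₁) (hV₂ : IsCanonicalVersion μ₂ W₂ V₂) :
    ∃ ρ ∈ couplings (canonicalMeasure μ₁ W₁) (canonicalMeasure μ₂ W₂),
      ∀ᵐ p : (canonicalSpace μ₁ W₁ × canonicalSpace μ₂ W₂) ×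
        (canonicalSpace μ₁ W₁ × canonicalSpace μ₂ W₂) ∂(ρ.toMeasure.prod ρ.toMeasure),
        V₁ p.1.1 p.2.1 = V₂ p.1.2 p.2.2 := by
  refine exists_coupling_ae_eq (V₁ := fun p => V₁ p.1 p.2) (V₂ := fun p => V₂ p.1 p.2)
    (integrable_of_abs_le V₁.measurable_toFun fun p => V₁.abs_le_one _ _)
    (integrable_of_abs_le V₂.measurable_toFun fun p => V₂.abs_le_one _ _) fun ε hε => ?_
  obtain ⟨δ, hδ, H⟩ := exists_integral_abs_le_of_cutNorm_lt (μ₁ := μ₁) (μ₂ := μ₂) W₁ W₂ hε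
  obtain ⟨Ω, _, μ, φ₁, φ₂, _, h₁, h₂, hlt⟩ := exists_coupling_cutNorm_lt h hδ
  have hle := H Ω μ φ₁ φ₂ h₁ h₂ hlt
  have t₁ := (measurePreserving_toCanonical μ₁ W₁).comp h₁
  have t₂ := (measurePreserving_toCanonical μ₂ W₂).comp h₂
  have hm := t₁.measurable.prodMk t₂.measurable
  have hρ : IsProbabilityMeasure (μ.map fun ω =>
      ((toCanonical μ₁ W₁ ∘ φ₁) ω, (toCanonical μ₂ W₂ ∘ φ₂) ω)) :=
    Measure.isProbabilityMeasure_map hm.aemeasurable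
  have hmp : MeasurePreserving
      (fun ω => ((toCanonical μ₁ W₁ ∘ φ₁) ω, (toCanonical μ₂ W₂ ∘ φ₂) ω)) μ
      (μ.map fun ω => ((toCanonical μ₁ W₁ ∘ φ₁) ω, (toCanonical μ₂ W₂ ∘ φ₂) ω)) := ⟨hm, rfl⟩
  refine ⟨⟨_, hρ⟩, ⟨⟨measurable_fst, ?_⟩, ⟨measurable_snd, ?_⟩⟩, le_trans (le_of_eq ?_) hle⟩
  · rw [ProbabilityMeasure.coe_mk, Measure.map_map measurable_fst hm]
    exact t₁.map_eq
  · rw [ProbabilityMeasure.coe_mk, Measure.map_map measurable_snd hm]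
    exact t₂.map_eq
  · rw [ProbabilityMeasure.coe_mk, ← (hmp.prod hmp).map_eq,
      integral_map (hmp.prod hmp).measurable.aemeasurable]
    · refine integral_congr_ae ?_
      have e₁ := (h₁.prod h₁).quasiMeasurePreserving.ae ((isCanonicalVersion_iff μ₁ W₁ V₁).1 hV₁)
      have e₂ := (h₂.prod h₂).quasiMeasurePreserving.ae ((isCanonicalVersion_iff μ₂ W₂ V₂).1 hV₂)
      filter_upwards [e₁, e₂] with p hp₁ hp₂
      change |V₁ (toCanonical μ₁ W₁ (φ₁ p.1)) (toCanonical μ₁ W₁ (φ₁ p.2)) -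
        V₂ (toCanonical μ₂ W₂ (φ₂ p.1)) (toCanonical μ₂ W₂ (φ₂ p.2))| = _
      exact congrArg _ (congrArg₂ _ hp₁ hp₂)
    · exact ((measurable_pullback V₁ measurable_fst).sub
        (measurable_pullback V₂ measurable_snd)).abs.aestronglyMeasurable

/-- An optimal coupling is carried by the graph of an isometry: distances in `S_W` are integrals
of differences of sections of the canonical graphon, and the coupling matches these sections. -/
theorem Equivalent.exists_isometryEquiv (h : Equivalent μ₁ W₁ μ₂ W₂)
    (hV₁ : IsCanonicalVersion μ₁ W₁ V₁) (hV₂ : IsCanonicalVersion μ₂ W₂ V₂) :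
    ∃ φ : canonicalSpace μ₁ W₁ ≃ᵢ canonicalSpace μ₂ W₂,
      MeasurePreserving φ (canonicalMeasure μ₁ W₁) (canonicalMeasure μ₂ W₂) ∧
      ∀ᵐ p ∂((canonicalMeasure μ₁ W₁).prod (canonicalMeasure μ₁ W₁)),
        pullback φ V₂ p.1 p.2 = V₁ p.1 p.2 := by
  obtain ⟨ρ, ⟨hρ₁, hρ₂⟩, hρ⟩ := h.exists_coupling hV₁ hV₂
  let H : Set (canonicalSpace μ₁ W₁ × canonicalSpace μ₂ W₂) :=
    {p | (∀ᵐ q ∂ρ.toMeasure, V₁ p.1 q.1 = V₂ p.2 q.2) ∧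
      (p.1 : Lp ℝ 1 μ₁) = toL1 μ₁ (fun y => V₁ p.1 (toCanonical μ₁ W₁ y)) ∧
      (p.2 : Lp ℝ 1 μ₂) = toL1 μ₂ (fun y => V₂ p.2 (toCanonical μ₂ W₂ y))}
  have hH : ∀ᵐ p ∂ρ.toMeasure, p ∈ H := by
    filter_upwards [Measure.ae_ae_of_ae_prod hρ, hρ₁.quasiMeasurePreserving.ae hV₁.ae_coe_eq,
      hρ₂.quasiMeasurePreserving.ae hV₂.ae_coe_eq] with p h1 h2 h3
    exact ⟨h1, h2, h3⟩
  have hd : ∀ p ∈ H, ∀ q ∈ H, dist p.1 q.1 = dist p.2 q.2 := by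
    rintro p ⟨hp, hp₁, hp₂⟩ q ⟨hq, hq₁, hq₂⟩
    rw [dist_eq_integral_section V₁ hp₁ hq₁, dist_eq_integral_section V₂ hp₂ hq₂,
      ← hρ₁.map_eq, ← hρ₂.map_eq, integral_map measurable_fst.aemeasurable,
      integral_map measurable_snd.aemeasurable]
    · refine integral_congr_ae ?_
      filter_upwards [hp, hq] with r hr₁ hr₂
      rw [hr₁, hr₂]
    · exact ((measurable_section V₂ _).sub (measurable_section V₂ _)).abs.aestronglyMeasurable
    · exact ((measurable_section V₁ _).sub (measurable_section V₁ _)).abs.aestronglyMeasurable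
  -- the projections are dense since `ρ` is carried by `H` and the canonical measures charge every
  -- nonempty open set
  have hdense₁ : Dense (Prod.fst '' H) := by
    refine dense_iff_inter_open.2 fun U hU hne => ?_
    have hpos : ρ.toMeasure (Prod.fst ⁻¹' U) ≠ 0 := by
      rw [hρ₁.measure_preimage hU.measurableSet.nullMeasurableSet]
      exact (hU.measure_pos _ hne).ne'
    obtain ⟨p, hp, hpH⟩ := ((frequently_ae_mem_iff.2 hpos).and_eventually hH).exists
    exact ⟨p.1, hp, p, hpH, rfl⟩
  have hdense₂ : Dense (Prod.snd '' H) := by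
    refine dense_iff_inter_open.2 fun U hU hne => ?_
    have hpos : ρ.toMeasure (Prod.snd ⁻¹' U) ≠ 0 := by
      rw [hρ₂.measure_preimage hU.measurableSet.nullMeasurableSet]
      exact (hU.measure_pos _ hne).ne'
    obtain ⟨p, hp, hpH⟩ := ((frequently_ae_mem_iff.2 hpos).and_eventually hH).exists
    exact ⟨p.2, hp, p, hpH, rfl⟩
  obtain ⟨φ, hφ⟩ := exists_isometryEquiv_of_dist_eq hd hdense₁ hdense₂
  have hφm : Measurable φ := φ.continuous.measurable
  have hgraph : ∀ᵐ p ∂ρ.toMeasure, φ p.1 = p.2 := hH.mono fun p hp => hφ p hp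
  refine ⟨φ, ⟨hφm, ?_⟩, ?_⟩
  · rw [← hρ₁.map_eq, Measure.map_map hφm measurable_fst, ← hρ₂.map_eq]
    exact Measure.map_congr hgraph
  · rw [← (hρ₁.prod hρ₁).map_eq, ae_map_iff (hρ₁.prod hρ₁).measurable.aemeasurable]
    · filter_upwards [hρ, Measure.quasiMeasurePreserving_fst.ae hgraph,
        Measure.quasiMeasurePreserving_snd.ae hgraph] with p hp hp₁ hp₂
      change V₂ (φ p.1.1) (φ p.2.1) = V₁ p.1.1 p.2.1
      rw [hp₁, hp₂, hp]
    · exact measurableSet_eq_fun (measurable_pullback V₂ hφm) V₁.measurable_toFun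

end Equivalence

/-! ### Gluing along finite partitions -/

section Gluing

variable {S₁ : Type u} [MeasurableSpace S₁] {μ₁ : Measure S₁} [IsProbabilityMeasure μ₁]
  {S₂ : Type v} [MeasurableSpace S₂] {μ₂ : Measure S₂} [IsProbabilityMeasure μ₂]

/-- Two probability spaces can be glued along maps to a finite set with the same law. This is a
substitute for gluing along maps to `S_W`, which may be impossible as the given spaces are
arbitrary. -/
theorem exists_coupling_of_map_eq {ι : Type*} [Fintype ι] [MeasurableSpace ι]
    [DiscreteMeasurableSpace ι] {a : S₁ → ι} {b : S₂ → ι} (ha : Measurable a) (hb : Measurable b)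
    (h : μ₁.map a = μ₂.map b) :
    ∃ π : Measure (S₁ × S₂), MeasurePreserving Prod.fst π μ₁ ∧ MeasurePreserving Prod.snd π μ₂ ∧
      ∀ᵐ p ∂π, a p.1 = b p.2 := by
  have hA : ∀ i, MeasurableSet (a ⁻¹' {i}) := fun i => ha (measurableSet_singleton i)
  have hB : ∀ i, MeasurableSet (b ⁻¹' {i}) := fun i => hb (measurableSet_singleton i)
  have hAB : ∀ i, μ₁ (a ⁻¹' {i}) = μ₂ (b ⁻¹' {i}) := fun i => by
    rw [← Measure.map_apply ha (measurableSet_singleton i), h,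
      Measure.map_apply hb (measurableSet_singleton i)]
  have hinv : ∀ i, μ₁ (a ⁻¹' {i}) ≠ 0 → (μ₁ (a ⁻¹' {i}))⁻¹ * μ₁ (a ⁻¹' {i}) = 1 := fun i hi =>
    ENNReal.inv_mul_cancel hi (measure_ne_top _ _)
  refine ⟨Measure.sum fun i => (μ₁ (a ⁻¹' {i}))⁻¹ •
    (μ₁.restrict (a ⁻¹' {i})).prod (μ₂.restrict (b ⁻¹' {i})), ⟨measurable_fst, ?_⟩,
    ⟨measurable_snd, ?_⟩, ?_⟩
  · rw [Measure.map_sum measurable_fst.aemeasurable]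
    have h1 : ∀ i, ((μ₁ (a ⁻¹' {i}))⁻¹ •
        (μ₁.restrict (a ⁻¹' {i})).prod (μ₂.restrict (b ⁻¹' {i}))).map Prod.fst =
        μ₁.restrict (a ⁻¹' {i}) := by
      intro i
      rw [Measure.map_smul, Measure.map_fst_prod, Measure.restrict_apply_univ, ← hAB, smul_smul]
      by_cases hi : μ₁ (a ⁻¹' {i}) = 0
      · rw [Measure.restrict_eq_zero.2 hi, smul_zero]
      · rw [hinv i hi, one_smul]
    simp_rw [h1]
    rw [← Measure.restrict_iUnion (fun i j hij => Disjoint.preimage a (by simpa using hij)) hA,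
      ← Set.preimage_iUnion, Set.iUnion_of_singleton, Set.preimage_univ, Measure.restrict_univ]
  · rw [Measure.map_sum measurable_snd.aemeasurable]
    have h1 : ∀ i, ((μ₁ (a ⁻¹' {i}))⁻¹ •
        (μ₁.restrict (a ⁻¹' {i})).prod (μ₂.restrict (b ⁻¹' {i}))).map Prod.snd =
        μ₂.restrict (b ⁻¹' {i}) := by
      intro i
      rw [Measure.map_smul, Measure.map_snd_prod, Measure.restrict_apply_univ, smul_smul]
      by_cases hi : μ₁ (a ⁻¹' {i}) = 0
      · rw [Measure.restrict_eq_zero.2 ((hAB i).symm.trans hi), smul_zero]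
      · rw [hinv i hi, one_smul]
    simp_rw [h1]
    rw [← Measure.restrict_iUnion (fun i j hij => Disjoint.preimage b (by simpa using hij)) hB,
      ← Set.preimage_iUnion, Set.iUnion_of_singleton, Set.preimage_univ, Measure.restrict_univ]
  · have hm : MeasurableSet {p : S₁ × S₂ | a p.1 = b p.2} :=
      measurableSet_eq_fun (ha.comp measurable_fst) (hb.comp measurable_snd)
    rw [Measure.ae_sum_iff' hm]
    intro i
    refine Measure.ae_smul_measure ?_ _
    rw [Measure.prod_restrict]
    filter_upwards [ae_restrict_mem ((hA i).prod (hB i))] with p hp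
    exact hp.1.trans hp.2.symm

variable {W₁ : Graphon S₁} {W₂ : Graphon S₂}
  {V₁ : Graphon (canonicalSpace μ₁ W₁)} {V₂ : Graphon (canonicalSpace μ₂ W₂)}

theorem integral_abs_version_sub_step {S : Type u} [MeasurableSpace S] {μ : Measure S}
    [IsProbabilityMeasure μ] {W : Graphon S} {V : Graphon (canonicalSpace μ W)}
    (hV : IsCanonicalVersion μ W V) {ι : Type*} [Fintype ι] [MeasurableSpace ι]
    [DiscreteMeasurableSpace ι] {κ : canonicalSpace μ W → ι} (hκ : Measurable κ)
    (c : ι → ι → ℝ) :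
    ∫ p, |V p.1 p.2 - c (κ p.1) (κ p.2)| ∂((canonicalMeasure μ W).prod (canonicalMeasure μ W)) =
      ∫ p, |W p.1 p.2 - c (κ (toCanonical μ W p.1)) (κ (toCanonical μ W p.2))| ∂(μ.prod μ) := by
  have hπ := measurePreserving_prodMap_toCanonical μ W
  rw [← hπ.map_eq, integral_map hπ.measurable.aemeasurable]
  · refine integral_congr_ae ?_
    filter_upwards [(isCanonicalVersion_iff μ W V).1 hV] with p hp
    rw [← hp]
    rfl
  · rw [hπ.map_eq]
    exact ((integrable_of_abs_le V.measurable_toFun fun p => V.abs_le_one _ _).sub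
      (integrable_step hκ c _)).abs.aestronglyMeasurable

/-- An isomorphism of the canonical graphons makes the graphons equivalent: couplings that match the
parts of finer and finer finite partitions of `S_{W₁}` have arbitrarily small cut norm. -/
theorem equivalent_of_measurableEquiv (hV₁ : IsCanonicalVersion μ₁ W₁ V₁)
    (hV₂ : IsCanonicalVersion μ₂ W₂ V₂)
    (φ : canonicalSpace μ₁ W₁ ≃ᵐ canonicalSpace μ₂ W₂)
    (hφ : MeasurePreserving φ (canonicalMeasure μ₁ W₁) (canonicalMeasure μ₂ W₂))
    (hV : ∀ᵐ p ∂((canonicalMeasure μ₁ W₁).prod (canonicalMeasure μ₁ W₁)),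
      pullback φ V₂ p.1 p.2 = V₁ p.1 p.2) :
    Equivalent μ₁ W₁ μ₂ W₂ := by
  refine le_antisymm (le_of_forall_pos_le_add fun ε hε => ?_) (Real.sInf_nonneg ?_)
  swap
  · rintro r ⟨Ω, m, μ, φ₁, φ₂, -, -, -, rfl⟩
    exact cutNorm_nonneg μ _
  obtain ⟨ι, _, _, _, κ, c, hκ, hc⟩ := stepApproximable_of_abs_le
    (μ := canonicalMeasure μ₁ W₁) V₁.measurable_toFun (fun p => V₁.abs_le_one p.1 p.2) (ε / 2)
    (half_pos hε)
  have hκ' : Measurable (κ ∘ φ.symm) := hκ.comp φ.symm.measurable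
  have t₁ := measurePreserving_toCanonical μ₁ W₁
  have t₂ := measurePreserving_toCanonical μ₂ W₂
  have ha : Measurable (κ ∘ toCanonical μ₁ W₁) := hκ.comp t₁.measurable
  have hb : Measurable ((κ ∘ φ.symm) ∘ toCanonical μ₂ W₂) := hκ'.comp t₂.measurable
  have hc₁ := hc
  rw [integral_abs_version_sub_step hV₁ hκ c] at hc₁
  have hc₂ : ∫ p, |W₂ p.1 p.2 - c ((κ ∘ φ.symm) (toCanonical μ₂ W₂ p.1))
      ((κ ∘ φ.symm) (toCanonical μ₂ W₂ p.2))| ∂(μ₂.prod μ₂) ≤ ε / 2 := by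
    rw [← integral_abs_version_sub_step hV₂ hκ' c, ← (hφ.prod hφ).map_eq,
      integral_map (hφ.prod hφ).measurable.aemeasurable]
    · refine le_trans (le_of_eq (integral_congr_ae ?_)) hc
      filter_upwards [hV] with p hp
      simp only [Prod.map_fst, Prod.map_snd, Function.comp_apply, MeasurableEquiv.symm_apply_apply]
      rw [← hp]
      rfl
    · rw [(hφ.prod hφ).map_eq]
      exact ((integrable_of_abs_le V₂.measurable_toFun fun p => V₂.abs_le_one _ _).sub
        (integrable_step hκ' c _)).abs.aestronglyMeasurable
  have hlaw : μ₁.map (κ ∘ toCanonical μ₁ W₁) = μ₂.map ((κ ∘ φ.symm) ∘ toCanonical μ₂ W₂) := by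
    rw [← Measure.map_map hκ t₁.measurable, ← Measure.map_map hκ' t₂.measurable, t₁.map_eq,
      t₂.map_eq, ← hφ.map_eq, Measure.map_map hκ' φ.measurable]
    congr 1
    ext x
    simp
  obtain ⟨π, hπ₁, hπ₂, hπ⟩ := exists_coupling_of_map_eq ha hb hlaw
  have hprob : IsProbabilityMeasure π := by
    refine ⟨?_⟩
    have h1 : π Set.univ = μ₁ Set.univ :=
      hπ₁.measure_preimage MeasurableSet.univ.nullMeasurableSet
    rw [h1, measure_univ]
  have hbdd : BddBelow {r : ℝ | ∃ (Ω : Type (max u v)) (_ : MeasurableSpace Ω) (μ : Measure Ω)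
      (φ₁ : Ω → S₁) (φ₂ : Ω → S₂),
      IsProbabilityMeasure μ ∧ MeasurePreserving φ₁ μ μ₁ ∧ MeasurePreserving φ₂ μ μ₂ ∧
        r = cutNorm μ (pullback φ₁ W₁ - pullback φ₂ W₂)} := by
    refine ⟨0, ?_⟩
    rintro r ⟨Ω, m, μ, φ₁, φ₂, -, -, -, rfl⟩
    exact cutNorm_nonneg μ _
  refine (csInf_le hbdd
    ⟨S₁ × S₂, inferInstance, π, Prod.fst, Prod.snd, hprob, hπ₁, hπ₂, rfl⟩).trans ?_
  have m₁ := hπ₁.prod hπ₁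
  have m₂ := hπ₂.prod hπ₂
  have w₁ : Integrable (fun p : S₁ × S₁ => W₁ p.1 p.2) (μ₁.prod μ₁) :=
    integrable_of_abs_le W₁.measurable_toFun fun p => W₁.abs_le_one _ _
  have w₂ : Integrable (fun p : S₂ × S₂ => W₂ p.1 p.2) (μ₂.prod μ₂) :=
    integrable_of_abs_le W₂.measurable_toFun fun p => W₂.abs_le_one _ _
  have s₁ := integrable_step ha c (μ₁.prod μ₁)
  have s₂ := integrable_step hb c (μ₂.prod μ₂)
  have i₁ := m₁.integrable_comp_of_integrable w₁
  have i₂ := m₂.integrable_comp_of_integrable w₂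
  have j₁ := m₁.integrable_comp_of_integrable s₁
  rw [zero_add]
  refine (cutNorm_le_integral_abs π (i₁.sub i₂)).trans ((integral_abs_sub_le i₁ j₁ i₂).trans ?_)
  have e₁ : ∫ p, |W₁ p.1.1 p.2.1 - c (κ (toCanonical μ₁ W₁ p.1.1)) (κ (toCanonical μ₁ W₁ p.2.1))|
      ∂(π.prod π) ≤ ε / 2 := by
    rw [← m₁.map_eq, integral_map m₁.measurable.aemeasurable] at hc₁
    · exact hc₁
    · rw [m₁.map_eq]
      exact (w₁.sub s₁).abs.aestronglyMeasurable
  have e₂ : ∫ p, |c (κ (toCanonical μ₁ W₁ p.1.1)) (κ (toCanonical μ₁ W₁ p.2.1)) - W₂ p.1.2 p.2.2|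
      ∂(π.prod π) ≤ ε / 2 := by
    rw [← m₂.map_eq, integral_map m₂.measurable.aemeasurable] at hc₂
    · refine le_trans (le_of_eq (integral_congr_ae ?_)) hc₂
      filter_upwards [Measure.quasiMeasurePreserving_fst.ae hπ,
        Measure.quasiMeasurePreserving_snd.ae hπ] with p hp hq
      have hp' : κ (toCanonical μ₁ W₁ p.1.1) = (κ ∘ φ.symm) (toCanonical μ₂ W₂ p.1.2) := hp
      have hq' : κ (toCanonical μ₁ W₁ p.2.1) = (κ ∘ φ.symm) (toCanonical μ₂ W₂ p.2.2) := hq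
      rw [hp', hq', abs_sub_comm]
      rfl
    · rw [m₂.map_eq]
      exact (w₂.sub s₂).abs.aestronglyMeasurable
  exact (add_le_add e₁ e₂).trans (add_halves ε).le

end Gluing

end Graphon

end

theorem theorem9p4 {S₁ : Type u} [MeasurableSpace S₁] (μ₁ : Measure S₁) [IsProbabilityMeasure μ₁]
    {S₂ : Type v} [MeasurableSpace S₂] (μ₂ : Measure S₂) [IsProbabilityMeasure μ₂]
    (W₁ : Graphon S₁) (W₂ : Graphon S₂) :
    -- the canonical graphons exist
    (∃ V₁, Graphon.IsCanonicalVersion μ₁ W₁ V₁) ∧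
    (∃ V₂, Graphon.IsCanonicalVersion μ₂ W₂ V₂) ∧
    -- the characterization of equivalence, whichever versions of them are chosen
    (∀ (V₁ : Graphon (Graphon.canonicalSpace μ₁ W₁)) (V₂ : Graphon (Graphon.canonicalSpace μ₂ W₂)),
      Graphon.IsCanonicalVersion μ₁ W₁ V₁ → Graphon.IsCanonicalVersion μ₂ W₂ V₂ →
      -- by a measure preserving bijection
      (Graphon.Equivalent μ₁ W₁ μ₂ W₂ ↔
        ∃ φ : Graphon.canonicalSpace μ₁ W₁ ≃ᵐ Graphon.canonicalSpace μ₂ W₂,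
          MeasurePreserving φ (Graphon.canonicalMeasure μ₁ W₁) (Graphon.canonicalMeasure μ₂ W₂) ∧
          ∀ᵐ p ∂((Graphon.canonicalMeasure μ₁ W₁).prod (Graphon.canonicalMeasure μ₁ W₁)),
            Graphon.pullback φ V₂ p.1 p.2 = V₁ p.1 p.2) ∧
      -- by an isometric measure preserving bijection
      (Graphon.Equivalent μ₁ W₁ μ₂ W₂ ↔
        ∃ φ : Graphon.canonicalSpace μ₁ W₁ ≃ᵢ Graphon.canonicalSpace μ₂ W₂,
          MeasurePreserving φ (Graphon.canonicalMeasure μ₁ W₁) (Graphon.canonicalMeasure μ₂ W₂) ∧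
          ∀ᵐ p ∂((Graphon.canonicalMeasure μ₁ W₁).prod (Graphon.canonicalMeasure μ₁ W₁)),
            Graphon.pullback φ V₂ p.1 p.2 = V₁ p.1 p.2)) ∧
    -- the canonical metric space is an invariant up to isometry
    (Graphon.Equivalent μ₁ W₁ μ₂ W₂ →
      Nonempty (Graphon.canonicalSpace μ₁ W₁ ≃ᵢ Graphon.canonicalSpace μ₂ W₂)) := by
  obtain ⟨U₁, hU₁⟩ := Graphon.exists_isCanonicalVersion μ₁ W₁
  obtain ⟨U₂, hU₂⟩ := Graphon.exists_isCanonicalVersion μ₂ W₂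
  refine ⟨⟨U₁, hU₁⟩, ⟨U₂, hU₂⟩, fun V₁ V₂ hV₁ hV₂ => ⟨⟨fun h => ?_, ?_⟩, fun h => ?_, ?_⟩,
    fun h => ?_⟩
  · obtain ⟨φ, hφ⟩ := h.exists_isometryEquiv hV₁ hV₂
    exact ⟨φ.toHomeomorph.toMeasurableEquiv, hφ⟩
  · rintro ⟨φ, hφ, hV⟩
    exact Graphon.equivalent_of_measurableEquiv hV₁ hV₂ φ hφ hV
  · exact h.exists_isometryEquiv hV₁ hV₂
  · rintro ⟨φ, hφ, hV⟩
    exact Graphon.equivalent_of_measurableEquiv hV₁ hV₂ φ.toHomeomorph.toMeasurableEquiv hφ hV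
  · obtain ⟨φ, -⟩ := h.exists_isometryEquiv hU₁ hU₂
    exact ⟨φ⟩
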